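/- A *hypergraph* $\Lambda=(V,E)$ consists of a finite set $V$ and a non-empty set $E$ of subsets of $V$; it is *full* if $\bigcup_{e\in E}e=V$; two hypergraphs are *isomorphic* if there is a bijection between their vertex sets under which a set of vertices of the second is an edge if and only if its preimage is an edge of the first. The game $\mathrm{HypIso}(\Lambda_1,\Lambda_2)$ has question and answer set $(V_1\sqcup V_2)\sqcup(E_1\sqcup E_2)$ for both players. Each player must answer a vertex (an edge) with a vertex (an edge) of the opposite hypergraph, and the relation between the two elements of $\Lambda_1$ among questions and answers must be the same as the relation between the corresponding two elements of $\Lambda_2$; the relations are equal / distinct and contained in a common edge / distinct and not contained in a common edge for two vertices, equal / distinct and intersecting / distinct and disjoint for two edges, and incident / not incident for a vertex and an edge. For finite simple graphs $G_1,G_2$ the game $\mathrm{Iso}(G_1,G_2)$ has question and answer set $V(G_1)\sqcup V(G_2)$; each player must answer with a vertex of the opposite graph and the relation (equal, distinct adjacent, distinct non-adjacent) must be preserved in the same sense. Write $\Lambda_1\cong_{\rm q}\Lambda_2$ (resp. $\Lambda_1\cong_{\rm loc}\Lambda_2$) if $\mathrm{HypIso}(\Lambda_1,\Lambda_2)$ has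 a perfect quantum (resp. local) strategy, that is, if some quantum (resp. local) correlation $p(a,b|x,y)$ vanishes on all losing tuples; here quantum means $p(a,b|x,y)=\langle(E_{x,a}\otimes F_{y,b})\xi,\xi\rangle$ for POVMs $(E_{x,a})_a$, $(F_{y,b})_b$ on finite-dimensional Hilbert spaces $H_A,H_B$ and a unit vector $\xi\in H_A\otimes H_B$, and local means a convex combination of products of conditional distributions of the two players. Write $G_1\cong_{\rm q}G_2$ if $\mathrm{Iso}(G_1,G_2)$ has a perfect quantum strategy. For one of these games, $\mathcal A(\cdot)$ denotes the unital complex $*$-algebra generated by self-adjoint idempotents $e_{x,a}$ subject to $\sum_a e_{x,a}=1$ for every question $x$ and $e_{x,a}e_{y,b}=0$ whenever the answers $a,b$ to the questions $x,y$ lose. The *neighbourhood hypergraph* $\mathcal N(G)$ of a finite non-empty simple graph $G$ has vertex set $V(G)$ and edges the open neighbourhoods of the vertices of $G$. Let $G(M,b)$ be the graph of the Mermin–Peres magic square: the variables are $x_{rc}\in\mathbb Z/2$ ($1\le r,c\le 3$), the constraints say that every row sum and the first two column sums are $0$ and that the third column sum is $1$; the vertices of the graph are the pairs $(\ell,a)$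 of a constraint $\ell$ and an assignment $a$ of its variables that satisfies it, and two vertices are adjacent if their assignments differ on some shared variable. Let $G(M,0)$ be the graph defined in the same way with all right-hand sides equal to $0$. **Theorem.** (1) There exist full hypergraphs $\Lambda_1,\Lambda_2$ such that $\Lambda_1\cong_{\rm q}\Lambda_2$ while $\Lambda_1\not\cong_{\rm loc}\Lambda_2$ and $\Lambda_1\not\cong\Lambda_2$. One can take $\Lambda_1=\mathcal N(G(M,b))$ and $\Lambda_2=\mathcal N(G(M,0))$; moreover $G(M,b)\cong_{\rm q}G(M,0)$ and $G(M,b)\not\cong G(M,0)$. (2) For all finite non-empty simple graphs $G_1,G_2$ there is a surjective unital $*$-homomorphism $\mathcal A(\mathrm{HypIso}(\mathcal N(G_1),\mathcal N(G_2)))\to\mathcal A(\mathrm{Iso}(G_1,G_2))$ that maps $e_{v_1,v_2}$ to $e_{v_1,v_2}$ for all $v_1\in V(G_1)$, $v_2\in V(G_2)$; and $G_1\cong_{\rm q}G_2$ implies $\mathcal N(G_1)\cong_{\rm q}\mathcal N(G_2)$. -/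

import Mathlib

open scoped TensorProduct

/-! ## Non-local games, correlations and perfect strategies -/

/-- A non-local game with question sets `X`, `Y` and answer sets `A`, `B`:
`rule x y a b` says that the answers `a`, `b` to the questions `x`, `y` win,
that is, `λ(x, y, a, b) = 1`. -/
structure NonlocalGame (X Y A B : Type*) where
  rule : X → Y → A → B → Prop

/-- A family of real numbers `p x y a b = p(a, b | x, y)`. -/
abbrev Correlation (X Y A B : Type*) := X → Y → A → B → ℝ

/-- `q` is a conditional probability distribution over `A` for each `x : X`. -/
def IsConditionalDistribution {X A : Type*} [Fintype A] (q : X → A → ℝ) : Prop :=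
  ∀ x, (∀ a, 0 ≤ q x a) ∧ ∑ a, q x a = 1

/-- Local correlations: convex combinations `∑ i, w i • (r i ⊗ s i)` of products of conditional
probability distributions. -/
def Correlation.IsLocal {X Y A B : Type*} [Fintype A] [Fintype B]
    (p : Correlation X Y A B) : Prop :=
  ∃ (k : ℕ) (w : Fin k → ℝ) (r : Fin k → X → A → ℝ) (s : Fin k → Y → B → ℝ),
    (∀ i, 0 ≤ w i) ∧ ∑ i, w i = 1 ∧
    (∀ i, IsConditionalDistribution (r i)) ∧ (∀ i, IsConditionalDistribution (s i)) ∧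
    ∀ x y a b, p x y a b = ∑ i, w i * (r i x a * s i y b)

/-- A positive operator-valued measure on `H` with outcome set `A`. -/
def IsPOVM {A : Type*} [Fintype A] {H : Type*} [NormedAddCommGroup H] [InnerProductSpace ℂ H]
    (E : A → (H →ₗ[ℂ] H)) : Prop :=
  (∀ a, (E a).IsPositive) ∧ ∑ a, E a = LinearMap.id

/-- Quantum correlations: `p(a, b | x, y) = ⟨(E x a ⊗ F y b) ξ, ξ⟩` for POVMs on
finite-dimensional Hilbert spaces and a unit vector `ξ` of the tensor product.
(In Mathlib the inner product is linear in the second variable.) -/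
def Correlation.IsQuantum {X Y A B : Type*} [Fintype A] [Fintype B]
    (p : Correlation X Y A B) : Prop :=
  ∃ (HA HB : Type) (_ : NormedAddCommGroup HA) (_ : InnerProductSpace ℂ HA)
    (_ : FiniteDimensional ℂ HA) (_ : NormedAddCommGroup HB) (_ : InnerProductSpace ℂ HB)
    (_ : FiniteDimensional ℂ HB) (ξ : HA ⊗[ℂ] HB)
    (E : X → A → (HA →ₗ[ℂ] HA)) (F : Y → B → (HB →ₗ[ℂ] HB)),
    ‖ξ‖ = 1 ∧ (∀ x, IsPOVM (E x)) ∧ (∀ y, IsPOVM (F y)) ∧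
    ∀ x y a b, (p x y a b : ℂ) = inner ℂ ξ (TensorProduct.map (E x a) (F y b) ξ)

namespace NonlocalGame

variable {X Y A B : Type*}

/-- A correlation is perfect for a game if losing answers have probability zero. -/
def IsPerfect (G : NonlocalGame X Y A B) (p : Correlation X Y A B) : Prop :=
  ∀ x y a b, ¬ G.rule x y a b → p x y a b = 0

/-- The game has a perfect `loc`-strategy. -/
def HasPerfectLocalStrategy [Fintype A] [Fintype B] (G : NonlocalGame X Y A B) : Prop :=
  ∃ p : Correlation X Y A B, p.IsLocal ∧ G.IsPerfect p

/-- The game has a perfect `q`-strategy. -/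
def HasPerfectQuantumStrategy [Fintype A] [Fintype B] (G : NonlocalGame X Y A B) : Prop :=
  ∃ p : Correlation X Y A B, p.IsQuantum ∧ G.IsPerfect p

end NonlocalGame

/-! ## The game `*`-algebra

The `*`-algebra generated by self-adjoint elements `e x a` with the relations below is the quotient
of the free complex algebra on the `e x a` by these relations and their adjoints, with the
conjugate-linear involution that reverses products and fixes every `e x a`. -/

section GameAlgebra

variable {X A : Type*} [Fintype A]

/-- The defining relations of the game algebra; `loseAdj` is the adjoint of `lose`. -/
inductive GameAlgebra.Rel (G : NonlocalGame X X A A) :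
    FreeAlgebra ℂ (X × A) → FreeAlgebra ℂ (X × A) → Prop
  | idem (x : X) (a : A) :
      Rel G (FreeAlgebra.ι ℂ (x, a) * FreeAlgebra.ι ℂ (x, a)) (FreeAlgebra.ι ℂ (x, a))
  | sum (x : X) : Rel G (∑ a, FreeAlgebra.ι ℂ (x, a)) 1
  | lose (x y : X) (a b : A) (h : ¬ G.rule x y a b) :
      Rel G (FreeAlgebra.ι ℂ (x, a) * FreeAlgebra.ι ℂ (y, b)) 0
  | loseAdj (x y : X) (a b : A) (h : ¬ G.rule x y a b) :
      Rel G (FreeAlgebra.ι ℂ (y, b) * FreeAlgebra.ι ℂ (x, a)) 0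

/-- The game `*`-algebra of a (synchronous) game. -/
def GameAlgebra (G : NonlocalGame X X A A) : Type _ := RingQuot (GameAlgebra.Rel G)

namespace GameAlgebra

variable (G : NonlocalGame X X A A)

noncomputable instance : Ring (GameAlgebra G) :=
  inferInstanceAs (Ring (RingQuot (GameAlgebra.Rel G)))

noncomputable instance : Algebra ℂ (GameAlgebra G) :=
  inferInstanceAs (Algebra ℂ (RingQuot (GameAlgebra.Rel G)))

/-- The quotient map from the free algebra. -/
noncomputable def mk : FreeAlgebra ℂ (X × A) →ₐ[ℂ] GameAlgebra G :=
  RingQuot.mkAlgHom ℂ (GameAlgebra.Rel G)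

/-- The canonical generators `e x a`. -/
noncomputable def gen (x : X) (a : A) : GameAlgebra G := mk G (FreeAlgebra.ι ℂ (x, a))

theorem mk_rel {u v : FreeAlgebra ℂ (X × A)} (h : GameAlgebra.Rel G u v) : mk G u = mk G v :=
  RingQuot.mkAlgHom_rel ℂ h

theorem mk_surjective : Function.Surjective (mk G) :=
  RingQuot.mkAlgHom_surjective ℂ (GameAlgebra.Rel G)

/-- The conjugate-linear anti-homomorphism on the free algebra that fixes the generators, followed
by the quotient map. -/
noncomputable def starAux : FreeAlgebra ℂ (X × A) →+* (GameAlgebra G)ᵐᵒᵖ :=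
  letI : Algebra ℂ (GameAlgebra G)ᵐᵒᵖ := Algebra.compHom _ (starRingEnd ℂ)
  (FreeAlgebra.lift ℂ (fun g : X × A => MulOpposite.op (gen G g.1 g.2))).toRingHom

theorem starAux_ι (x : X) (a : A) :
    starAux G (FreeAlgebra.ι ℂ (x, a)) = MulOpposite.op (gen G x a) := by
  let _ : Algebra ℂ (GameAlgebra G)ᵐᵒᵖ := Algebra.compHom _ (starRingEnd ℂ)
  exact FreeAlgebra.lift_ι_apply (R := ℂ)
    (fun g : X × A => MulOpposite.op (gen G g.1 g.2)) (x, a)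

theorem starAux_algebraMap (c : ℂ) :
    starAux G (algebraMap ℂ _ c) =
      MulOpposite.op (algebraMap ℂ (GameAlgebra G) ((starRingEnd ℂ) c)) := by
  let _ : Algebra ℂ (GameAlgebra G)ᵐᵒᵖ := Algebra.compHom _ (starRingEnd ℂ)
  exact (FreeAlgebra.lift ℂ (fun g : X × A => MulOpposite.op (gen G g.1 g.2))).commutes c

theorem starAux_rel ⦃u v : FreeAlgebra ℂ (X × A)⦄ (h : GameAlgebra.Rel G u v) :
    starAux G u = starAux G v := by
  cases h with
  | idem x a =>
    rw [map_mul, starAux_ι, ← MulOpposite.op_mul]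
    congr 1
    simpa [gen] using mk_rel G (.idem x a)
  | sum x =>
    have h := mk_rel G (.sum x)
    rw [map_sum, map_one] at h
    rw [map_sum, map_one]
    simp only [starAux_ι]
    apply MulOpposite.unop_injective
    simpa [gen] using h
  | lose x y a b h =>
    rw [map_mul, map_zero, starAux_ι, starAux_ι, ← MulOpposite.op_mul]
    have h := mk_rel G (.loseAdj x y a b h)
    rw [map_mul, map_zero] at h
    exact congrArg MulOpposite.op h
  | loseAdj x y a b h =>
    rw [map_mul, map_zero, starAux_ι, starAux_ι, ← MulOpposite.op_mul]
    have h := mk_rel G (.lose x y a b h)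
    rw [map_mul, map_zero] at h
    exact congrArg MulOpposite.op h

/-- The involution of the game algebra, as a ring homomorphism to the opposite ring. -/
noncomputable def starHom : GameAlgebra G →+* (GameAlgebra G)ᵐᵒᵖ :=
  RingQuot.lift ⟨starAux G, starAux_rel G⟩

theorem starHom_mk (u : FreeAlgebra ℂ (X × A)) : starHom G (mk G u) = starAux G u := by
  have h : mk G u = RingQuot.mkRingHom (GameAlgebra.Rel G) u := by
    simp only [mk, ← RingQuot.mkAlgHom_coe ℂ]
    rfl
  rw [h]
  exact RingQuot.lift_mkRingHom_apply (starAux G) (starAux_rel G) u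

theorem starHom_starHom (t : GameAlgebra G) : (starHom G (starHom G t).unop).unop = t := by
  obtain ⟨u, rfl⟩ := mk_surjective G t
  induction u using FreeAlgebra.induction with
  | grade0 c =>
    rw [starHom_mk, starAux_algebraMap, MulOpposite.unop_op, ← (mk G).commutes, starHom_mk,
      starAux_algebraMap, MulOpposite.unop_op, Complex.conj_conj, ← (mk G).commutes]
  | grade1 g =>
    rw [starHom_mk, starAux_ι, MulOpposite.unop_op, gen, starHom_mk, starAux_ι]
    rfl
  | mul a b ha hb => rw [map_mul, map_mul, MulOpposite.unop_mul, map_mul, MulOpposite.unop_mul,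
      ha, hb]
  | add a b ha hb => rw [map_add, map_add, MulOpposite.unop_add, map_add, MulOpposite.unop_add,
      ha, hb]

noncomputable instance : StarRing (GameAlgebra G) where
  star t := (starHom G t).unop
  star_involutive := starHom_starHom G
  star_mul a b := by rw [map_mul, MulOpposite.unop_mul]
  star_add a b := by rw [map_add, MulOpposite.unop_add]

theorem star_gen (x : X) (a : A) : star (gen G x a) = gen G x a := by
  change (starHom G (mk G _)).unop = _
  rw [starHom_mk, starAux_ι]
  rfl

instance : StarModule ℂ (GameAlgebra G) where
  star_smul c t := by
    change (starHom G (c • t)).unop = star c • (starHom G t).unop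
    rw [Algebra.smul_def, map_mul, MulOpposite.unop_mul, ← (mk G).commutes, starHom_mk,
      starAux_algebraMap, MulOpposite.unop_op, Algebra.smul_def]
    exact (Algebra.commutes _ _).symm

end GameAlgebra

end GameAlgebra

/-! ## Hypergraphs -/

/-- A hypergraph whose vertex set is the (finite) type `V`: a non-empty set of subsets of `V`.
(Mathlib's `Hypergraph` also allows infinite vertex sets and an empty edge set, and takes its
vertices in an ambient type.) -/
structure FiniteHypergraph (V : Type*) where
  edges : Finset (Finset V)
  edges_nonempty : edges.Nonempty

namespace FiniteHypergraph

variable {V V₁ V₂ : Type*}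

/-- The type of hyperedges. -/
abbrev Edge (Λ : FiniteHypergraph V) := {e : Finset V // e ∈ Λ.edges}

/-- A hypergraph is full if its edges cover the vertex set. -/
def IsFull (Λ : FiniteHypergraph V) : Prop := ∀ v, ∃ e ∈ Λ.edges, v ∈ e

/-- Two vertices lie in a common edge. -/
def Adj (Λ : FiniteHypergraph V) (v w : V) : Prop := ∃ e ∈ Λ.edges, v ∈ e ∧ w ∈ e

/-- (Classical) isomorphism: a bijection of the vertices under which a set of vertices of the
second hypergraph is an edge if and only if its preimage is an edge of the first. -/
def IsIsomorphic (Λ₁ : FiniteHypergraph V₁) (Λ₂ : FiniteHypergraph V₂) : Prop :=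
  ∃ f : V₁ ≃ V₂, ∀ e : Finset V₂, e.map f.symm.toEmbedding ∈ Λ₁.edges ↔ e ∈ Λ₂.edges

end FiniteHypergraph

/-- If `x` and `a` lie in opposite summands of `S ⊕ T`, the pair consisting of the element in `S`
and the element in `T`. -/
def swapPair {S T : Type*} : S ⊕ T → S ⊕ T → Option (S × T)
  | .inl s, .inr t => some (s, t)
  | .inr t, .inl s => some (s, t)
  | _, _ => none

/-- The graph isomorphism game `Iso(G₁, G₂)`: each player answers with a vertex of the opposite
graph, and the relation (equal; distinct adjacent; distinct non-adjacent) between the two vertices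
of `G₁` involved is the same as that between the two vertices of `G₂`. -/
def isoGame {V₁ V₂ : Type*} (G₁ : SimpleGraph V₁) (G₂ : SimpleGraph V₂) :
    NonlocalGame (V₁ ⊕ V₂) (V₁ ⊕ V₂) (V₁ ⊕ V₂) (V₁ ⊕ V₂) where
  rule x y a b := ∃ p q, swapPair x a = some p ∧ swapPair y b = some q ∧
    (p.1 = q.1 ↔ p.2 = q.2) ∧ (G₁.Adj p.1 q.1 ↔ G₂.Adj p.2 q.2)

namespace FiniteHypergraph

variable {V₁ V₂ : Type*}

/-- The question (and answer) set `(V₁ ⊔ V₂) ⊔ (E₁ ⊔ E₂)` of the hypergraph isomorphism game. -/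
abbrev Question (Λ₁ : FiniteHypergraph V₁) (Λ₂ : FiniteHypergraph V₂) := (V₁ ⊕ V₂) ⊕ (Λ₁.Edge ⊕ Λ₂.Edge)

/-- If the answer `a` has the same type (vertex or edge) as the question `x` and belongs to the
opposite hypergraph, the pair of vertices, or of edges, that `x` and `a` form. -/
def typedPair (Λ₁ : FiniteHypergraph V₁) (Λ₂ : FiniteHypergraph V₂) :
    Question Λ₁ Λ₂ → Question Λ₁ Λ₂ → Option ((V₁ × V₂) ⊕ (Λ₁.Edge × Λ₂.Edge))
  | .inl x, .inl a => (swapPair x a).map .inl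
  | .inr x, .inr a => (swapPair x a).map .inr
  | _, _ => none

/-- Preservation of relations: equal / distinct and adjacent / distinct and non-adjacent for
vertices, equal / distinct and intersecting / distinct and disjoint for edges, and incidence
between a vertex and an edge. -/
def SameRelation (Λ₁ : FiniteHypergraph V₁) (Λ₂ : FiniteHypergraph V₂) :
    (V₁ × V₂) ⊕ (Λ₁.Edge × Λ₂.Edge) → (V₁ × V₂) ⊕ (Λ₁.Edge × Λ₂.Edge) → Prop
  | .inl (v₁, v₂), .inl (w₁, w₂) =>
      (v₁ = w₁ ↔ v₂ = w₂) ∧ (v₁ ≠ w₁ → (Λ₁.Adj v₁ w₁ ↔ Λ₂.Adj v₂ w₂))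
  | .inr (e₁, e₂), .inr (f₁, f₂) =>
      (e₁ = f₁ ↔ e₂ = f₂) ∧
        (e₁ ≠ f₁ → ((∃ v, v ∈ e₁.1 ∧ v ∈ f₁.1) ↔ (∃ v, v ∈ e₂.1 ∧ v ∈ f₂.1)))
  | .inl (v₁, v₂), .inr (e₁, e₂) => v₁ ∈ e₁.1 ↔ v₂ ∈ e₂.1
  | .inr (e₁, e₂), .inl (v₁, v₂) => v₁ ∈ e₁.1 ↔ v₂ ∈ e₂.1

/-- The hypergraph isomorphism game `HypIso(Λ₁, Λ₂)`. -/
def hypIsoGame (Λ₁ : FiniteHypergraph V₁) (Λ₂ : FiniteHypergraph V₂) :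
    NonlocalGame (Question Λ₁ Λ₂) (Question Λ₁ Λ₂) (Question Λ₁ Λ₂) (Question Λ₁ Λ₂) where
  rule x y a b := ∃ P Q, typedPair Λ₁ Λ₂ x a = some P ∧ typedPair Λ₁ Λ₂ y b = some Q ∧
    SameRelation Λ₁ Λ₂ P Q

/-- `Λ₁ ≅_loc Λ₂`. -/
def LocIsomorphic [Fintype V₁] [Fintype V₂] (Λ₁ : FiniteHypergraph V₁) (Λ₂ : FiniteHypergraph V₂) : Prop :=
  (hypIsoGame Λ₁ Λ₂).HasPerfectLocalStrategy

/-- `Λ₁ ≅_q Λ₂`. -/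
def QuantumIsomorphic [Fintype V₁] [Fintype V₂] (Λ₁ : FiniteHypergraph V₁) (Λ₂ : FiniteHypergraph V₂) :
    Prop :=
  (hypIsoGame Λ₁ Λ₂).HasPerfectQuantumStrategy

end FiniteHypergraph

/-- The neighbourhood hypergraph of a graph: its edges are the (open) neighbourhoods of the
vertices. -/
def SimpleGraph.neighborhoodHypergraph {V : Type*} [Fintype V] [DecidableEq V] [Nonempty V]
    (G : SimpleGraph V) [DecidableRel G.Adj] : FiniteHypergraph V where
  edges := Finset.univ.image fun v => G.neighborFinset v
  edges_nonempty := Finset.univ_nonempty.image _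

/-! ## Binary constraint systems and the magic square -/

/-- A binary constraint system with variables `ι` and constraints `κ`: constraint `l` says that the
sum modulo two of the variables in `support l` equals `parity l`. -/
structure BCS (ι κ : Type*) where
  support : κ → Finset ι
  parity : κ → ZMod 2

namespace BCS

variable {ι κ : Type*}

/-- All right-hand sides are replaced by zero. -/
def homogenization (F : BCS ι κ) : BCS ι κ where
  support := F.support
  parity _ := 0

/-- The assignments of the variables of constraint `l` that satisfy it. -/
abbrev Sat (F : BCS ι κ) (l : κ) := {a : F.support l → ZMod 2 // ∑ i, a i = F.parity l}

/-- A constraint together with an assignment that satisfies it. -/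
abbrev Vertex (F : BCS ι κ) := Σ l : κ, F.Sat l

/-- The graph of a binary constraint system: two vertices are adjacent if their assignments
conflict on some shared variable. -/
def graph (F : BCS ι κ) : SimpleGraph F.Vertex where
  Adj u v := ∃ (i : ι) (hu : i ∈ F.support u.1) (hv : i ∈ F.support v.1),
    u.2.1 ⟨i, hu⟩ ≠ v.2.1 ⟨i, hv⟩
  symm := ⟨fun _ _ ⟨i, hu, hv, h⟩ => ⟨i, hv, hu, h.symm⟩⟩
  loopless := ⟨fun _ ⟨_, _, _, h⟩ => h rfl⟩

instance [Fintype ι] [DecidableEq ι] (F : BCS ι κ) : DecidableRel F.graph.Adj :=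
  fun u v => inferInstanceAs (Decidable (∃ (i : ι) (hu : i ∈ F.support u.1)
    (hv : i ∈ F.support v.1), u.2.1 ⟨i, hu⟩ ≠ v.2.1 ⟨i, hv⟩))

/-- The Mermin-Peres magic square: nine variables in a `3 × 3` array, one constraint for each row
(`Sum.inl r`) and each column (`Sum.inr c`); the parity is odd for the last column only. -/
def magicSquare : BCS (Fin 3 × Fin 3) (Fin 3 ⊕ Fin 3) where
  support
    | .inl r => Finset.univ.filter fun i => i.1 = r
    | .inr c => Finset.univ.filter fun i => i.2 = c
  parity
    | .inl _ => 0
    | .inr c => if c = 2 then 1 else 0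

instance : Nonempty magicSquare.Vertex := ⟨⟨.inl 0, fun _ => 0, by simp [magicSquare]⟩⟩

instance : Nonempty magicSquare.homogenization.Vertex :=
  ⟨⟨.inl 0, fun _ => 0, by simp [homogenization]⟩⟩

end BCS

/-! Adjacency and edge intersection in a neighbourhood hypergraph, and equality of its edges, are
not relations preserved outright by `isoGame`: they quantify over a third vertex. The missing input
is that operators of a perfect strategy vanish on more than the losing tuples. Inserting the
resolution of the identity of a further question `z` between two generators gives `e_{x,a} e_{y,b} =
∑ c, e_{x,a} e_{z,c} e_{y,b}`, so the product is zero unless every `z` has an answer compatible with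
both sides (`Extendable`). Extendable pairs do preserve two-step walks and equality of
neighbourhoods. Replacing an edge by a vertex with that neighbourhood, and an answered vertex by its
neighbourhood, therefore carries both quantum strategies (`HasPerfectQuantumStrategy.of_extendable`)
and game algebras (`exists_starAlgHom_of_extendable`) from graphs to hypergraphs.

For the magic square, the joint eigenprojections of the Mermin–Peres observables, arranged in
`pairMatrix` and measured on a maximally entangled state, win the graph game. Classically, a perfect
local strategy yields a hypergraph isomorphism, which preserves codegrees. Codegrees here count
common neighbours. Those of the six zero assignments of the homogeneous system force their preimages
to be pairwise non-adjacent, one for each constraint. Such a family would be a solution of the magic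
square, which has none. -/

namespace TensorProduct

variable {R M N ι : Type*} [CommSemiring R] [AddCommMonoid M] [Module R M] [AddCommMonoid N]
  [Module R N]

theorem map_sum_left (s : Finset ι) (S : ι → (M →ₗ[R] M)) (T : N →ₗ[R] N) :
    map (∑ i ∈ s, S i) T = ∑ i ∈ s, map (S i) T :=
  map_sum ((mapBilinear (.id R) M N M N).flip T) S s

theorem map_sum_right (s : Finset ι) (S : M →ₗ[R] M) (T : ι → (N →ₗ[R] N)) :
    map S (∑ i ∈ s, T i) = ∑ i ∈ s, map S (T i) :=
  map_sum (mapBilinear (.id R) M N M N S) T s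

end TensorProduct

/-! ### Positive operators on tensor products -/

section PositiveOperators

variable {HA HB : Type*} [NormedAddCommGroup HA] [InnerProductSpace ℂ HA] [FiniteDimensional ℂ HA]
  [NormedAddCommGroup HB] [InnerProductSpace ℂ HB] [FiniteDimensional ℂ HB]

theorem LinearMap.IsPositive.exists_eq_adjoint_comp_self {T : HA →ₗ[ℂ] HA} (hT : T.IsPositive) :
    ∃ S : HA →ₗ[ℂ] HA, T = S.adjoint ∘ₗ S := by
  have : CompleteSpace HA := FiniteDimensional.complete ℂ HA
  have h : 0 ≤ LinearMap.toContinuousLinearMap T := by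
    rw [ContinuousLinearMap.nonneg_iff_isPositive]
    exact (LinearMap.isPositive_toContinuousLinearMap_iff T).2 hT
  obtain ⟨S, hS⟩ := CStarAlgebra.nonneg_iff_eq_star_mul_self.1 h
  refine ⟨S.toLinearMap, ?_⟩
  ext x
  have := congrArg (fun f : HA →L[ℂ] HA => f x) hS
  exact this

/-- A product of positive operators whose expectation in `ξ` vanishes annihilates `ξ`. -/
theorem TensorProduct.map_apply_eq_zero_of_inner_eq_zero {S : HA →ₗ[ℂ] HA} {T : HB →ₗ[ℂ] HB}
    (hS : S.IsPositive) (hT : T.IsPositive) {ξ : HA ⊗[ℂ] HB}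
    (h : inner ℂ ξ (TensorProduct.map S T ξ) = 0) : TensorProduct.map S T ξ = 0 := by
  obtain ⟨P, rfl⟩ := hS.exists_eq_adjoint_comp_self
  obtain ⟨Q, rfl⟩ := hT.exists_eq_adjoint_comp_self
  rw [TensorProduct.map_comp, LinearMap.comp_apply, ← TensorProduct.adjoint_map,
    LinearMap.adjoint_inner_right, inner_self_eq_zero] at h
  rw [TensorProduct.map_comp, LinearMap.comp_apply, h, map_zero]

end PositiveOperators

/-! ### Synchronous games: extra vanishing and translation of quantum strategies -/

namespace NonlocalGame

/-- Equal questions must receive equal answers. -/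
def IsSynchronous {X A : Type*} (G : NonlocalGame X X A A) : Prop :=
  ∀ x a b, G.rule x x a b → a = b

/-- The answers `a`, `b` to `x`, `y` win, and for every further question `z` there is an answer
which wins against both of them. -/
def Extendable {X A : Type*} (G : NonlocalGame X X A A) (x y : X) (a b : A) : Prop :=
  G.rule x y a b ∧ ∀ z, ∃ c, G.rule x z a c ∧ G.rule z y c b

section Quantum

variable {X A : Type*} [Fintype A] {G : NonlocalGame X X A A}
  {HA HB : Type*} [NormedAddCommGroup HA] [InnerProductSpace ℂ HA]
  [NormedAddCommGroup HB] [InnerProductSpace ℂ HB]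
  {ξ : HA ⊗[ℂ] HB} {E : X → A → (HA →ₗ[ℂ] HA)} {F : X → A → (HB →ₗ[ℂ] HB)}

/-- Expanding the identity on either leg as the sum of the POVM of `x`, only the diagonal term `E x
a ⊗ F x a` survives on `ξ`. This lets an operator acting on `ξ` be moved from one leg to the other.
-/
theorem IsSynchronous.map_id_apply_eq (hG : G.IsSynchronous) (hE : ∀ x, IsPOVM (E x))
    (hF : ∀ x, IsPOVM (F x))
    (h : ∀ x y a b, ¬ G.rule x y a b → TensorProduct.map (E x a) (F y b) ξ = 0) (x : X) (a : A) :
    TensorProduct.map (E x a) LinearMap.id ξ = TensorProduct.map LinearMap.id (F x a) ξ := by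
  have h₁ : TensorProduct.map (E x a) LinearMap.id ξ = TensorProduct.map (E x a) (F x a) ξ := by
    rw [← (hF x).2, TensorProduct.map_sum_right, LinearMap.sum_apply]
    exact Finset.sum_eq_single a (fun b _ hb => h x x a b fun hr => hb (hG x a b hr).symm) (by simp)
  have h₂ : TensorProduct.map LinearMap.id (F x a) ξ = TensorProduct.map (E x a) (F x a) ξ := by
    rw [← (hE x).2, TensorProduct.map_sum_left, LinearMap.sum_apply]
    exact Finset.sum_eq_single a (fun b _ hb => h x x b a fun hr => hb (hG x b a hr)) (by simp)
  rw [h₁, h₂]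

/-- Take a question `z` with no answer compatible with both sides and insert `∑ c, E z c = 1` next
to `E x a`. Each term dies, either because `c` loses against `b`, or because `c` loses against `a`
once `E z c` has been moved to the second leg. -/
theorem IsSynchronous.map_apply_eq_zero (hG : G.IsSynchronous) (hE : ∀ x, IsPOVM (E x))
    (hF : ∀ x, IsPOVM (F x))
    (h : ∀ x y a b, ¬ G.rule x y a b → TensorProduct.map (E x a) (F y b) ξ = 0)
    {x y : X} {a b : A} (hab : ¬ G.Extendable x y a b) :
    TensorProduct.map (E x a) (F y b) ξ = 0 := by
  by_cases hr : G.rule x y a b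
  swap
  · exact h x y a b hr
  simp only [Extendable, hr, true_and, not_forall, not_exists] at hab
  obtain ⟨z, hz⟩ := hab
  have hsum : TensorProduct.map (E x a) (F y b) ξ =
      ∑ c, TensorProduct.map (E x a ∘ₗ E z c) (F y b) ξ := by
    rw [← LinearMap.sum_apply, ← TensorProduct.map_sum_left]
    congr 2
    simp only [← Module.End.mul_eq_comp]
    rw [← Finset.mul_sum, (hE z).2, ← Module.End.one_eq_id, mul_one]
  rw [hsum]
  refine Finset.sum_eq_zero fun c _ => ?_
  by_cases hzy : G.rule z y c b
  · have hxz : ¬ G.rule x z a c := fun hxz => hz c ⟨hxz, hzy⟩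
    have h₁ : TensorProduct.map (E x a ∘ₗ E z c) (F y b) =
        TensorProduct.map (E x a) (F y b) ∘ₗ TensorProduct.map (E z c) LinearMap.id := by
      rw [← TensorProduct.map_comp, LinearMap.comp_id]
    have h₂ : TensorProduct.map (E x a) (F y b) ∘ₗ TensorProduct.map LinearMap.id (F z c) =
        TensorProduct.map LinearMap.id (F y b) ∘ₗ TensorProduct.map (E x a) (F z c) := by
      rw [← TensorProduct.map_comp, ← TensorProduct.map_comp, LinearMap.comp_id, LinearMap.id_comp]
    rw [h₁, LinearMap.comp_apply, hG.map_id_apply_eq hE hF h, ← LinearMap.comp_apply, h₂,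
      LinearMap.comp_apply, h x z a c hxz, map_zero]
  · have h₁ : TensorProduct.map (E x a ∘ₗ E z c) (F y b) =
        TensorProduct.map (E x a) LinearMap.id ∘ₗ TensorProduct.map (E z c) (F y b) := by
      rw [← TensorProduct.map_comp, LinearMap.id_comp]
    rw [h₁, LinearMap.comp_apply, h z y c b hzy, map_zero]

end Quantum

section Reduction

variable {X A X' A' : Type*} [Fintype A] [Fintype A'] [DecidableEq A']

/-- Answer a question `x'` of `G'` by translating it into the question `σ x'` of `G` and the answer
`a` to the latter into `τ x' a`. -/
theorem HasPerfectQuantumStrategy.of_extendable {G : NonlocalGame X X A A}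
    {G' : NonlocalGame X' X' A' A'} (hG : G.IsSynchronous) (σ : X' → X) (τ : X' → A → A')
    (hστ : ∀ x y a b, G.Extendable (σ x) (σ y) a b → G'.rule x y (τ x a) (τ y b))
    (h : G.HasPerfectQuantumStrategy) : G'.HasPerfectQuantumStrategy := by
  obtain ⟨p, ⟨HA, HB, _, _, _, _, _, _, ξ, E, F, hξ, hE, hF, hp⟩, hperf⟩ := h
  have h0 : ∀ x y a b, ¬ G.rule x y a b → TensorProduct.map (E x a) (F y b) ξ = 0 := by
    intro x y a b hr
    refine TensorProduct.map_apply_eq_zero_of_inner_eq_zero ((hE x).1 a) ((hF y).1 b) ?_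
    rw [← hp, hperf x y a b hr, Complex.ofReal_zero]
  have hsum : ∀ {H : Type} [NormedAddCommGroup H] [InnerProductSpace ℂ H]
      (D : X → A → (H →ₗ[ℂ] H)), (∀ x, IsPOVM (D x)) → ∀ x' : X',
      IsPOVM fun a' : A' => ∑ a with τ x' a = a', D (σ x') a := by
    intro H _ _ D hD x'
    refine ⟨fun a' => LinearMap.isPositive_sum _ fun a _ => (hD _).1 a, ?_⟩
    rw [Finset.sum_fiberwise, (hD _).2]
  have hexp : ∀ x y a b,
      TensorProduct.map (∑ c with τ x c = a, E (σ x) c) (∑ d with τ y d = b, F (σ y) d) ξ =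
        ∑ c with τ x c = a, ∑ d with τ y d = b,
          TensorProduct.map (E (σ x) c) (F (σ y) d) ξ := by
    intro x y a b
    simp only [TensorProduct.map_sum_left, TensorProduct.map_sum_right, LinearMap.sum_apply]
    exact Finset.sum_comm
  -- Classical post-processing: the same state, with the POVM elements summed over the fibres of
  -- `τ`.
  refine ⟨fun x y a b => ∑ c with τ x c = a, ∑ d with τ y d = b, p (σ x) (σ y) c d,
    ⟨HA, HB, _, _, ‹_›, _, _, ‹_›, ξ, fun x' a' => ∑ a with τ x' a = a', E (σ x') a,
      fun x' a' => ∑ a with τ x' a = a', F (σ x') a, hξ, hsum E hE, hsum F hF, ?_⟩, ?_⟩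
  · intro x y a b
    simp only [hexp, Complex.ofReal_sum, inner_sum, hp]
  · intro x y a b hr
    refine Finset.sum_eq_zero fun c hc => Finset.sum_eq_zero fun d hd => ?_
    simp only [Finset.mem_filter, Finset.mem_univ, true_and] at hc hd
    subst hc hd
    have := hG.map_apply_eq_zero hE hF h0 (mt (hστ x y c d) hr)
    rw [← Complex.ofReal_eq_zero, hp, this, inner_zero_right]

end Reduction

end NonlocalGame

/-! ### Vanishing products and homomorphisms of game algebras -/

namespace GameAlgebra

variable {X A : Type*} [Fintype A] (G : NonlocalGame X X A A)

theorem gen_mul_self (x : X) (a : A) : gen G x a * gen G x a = gen G x a := by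
  simpa [gen] using mk_rel G (.idem x a)

theorem sum_gen (x : X) : ∑ a, gen G x a = 1 := by
  simpa [gen] using mk_rel G (.sum x)

variable {G}

theorem gen_mul_gen_eq_zero {x y : X} {a b : A} (h : ¬ G.rule x y a b) :
    gen G x a * gen G y b = 0 := by
  simpa [gen] using mk_rel G (.lose x y a b h)

/-- Algebraic counterpart of `IsSynchronous.map_apply_eq_zero`: insert `∑ c, gen G z c = 1` between
the two factors. -/
theorem gen_mul_gen_eq_zero_of_not_extendable {x y : X} {a b : A} (h : ¬ G.Extendable x y a b) :
    gen G x a * gen G y b = 0 := by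
  by_cases hr : G.rule x y a b
  swap
  · exact gen_mul_gen_eq_zero hr
  simp only [NonlocalGame.Extendable, hr, true_and, not_forall, not_exists] at h
  obtain ⟨z, hz⟩ := h
  rw [← mul_one (gen G x a), ← sum_gen G z, Finset.mul_sum, Finset.sum_mul]
  refine Finset.sum_eq_zero fun c _ => ?_
  by_cases hxz : G.rule x z a c
  · rw [mul_assoc, gen_mul_gen_eq_zero fun hzy => hz c ⟨hxz, hzy⟩, mul_zero]
  · rw [gen_mul_gen_eq_zero hxz, zero_mul]

section Lift

variable {B : Type*} [Ring B] [StarRing B] [Algebra ℂ B] [StarModule ℂ B]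

/-- The universal property of the game algebra. -/
theorem exists_starAlgHom (f : X → A → B) (hstar : ∀ x a, star (f x a) = f x a)
    (hidem : ∀ x a, f x a * f x a = f x a) (hsum : ∀ x, ∑ a, f x a = 1)
    (hlose : ∀ x y a b, ¬ G.rule x y a b → f x a * f y b = 0) :
    ∃ φ : GameAlgebra G →⋆ₐ[ℂ] B, ∀ x a, φ (gen G x a) = f x a := by
  have hrel : ∀ ⦃u v : FreeAlgebra ℂ (X × A)⦄, Rel G u v →
      FreeAlgebra.lift ℂ (fun g : X × A => f g.1 g.2) u =
        FreeAlgebra.lift ℂ (fun g : X × A => f g.1 g.2) v := by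
    intro u v h
    cases h with
    | idem x a => simp [hidem]
    | sum x => simp [hsum]
    | lose x y a b h => simp [hlose x y a b h]
    | loseAdj x y a b h =>
      have := congrArg star (hlose x y a b h)
      rw [star_mul, hstar, hstar, star_zero] at this
      simp [this]
  let ψ : GameAlgebra G →ₐ[ℂ] B := RingQuot.liftAlgHom ℂ ⟨_, hrel⟩
  have hψ : ∀ u, ψ (mk G u) = FreeAlgebra.lift ℂ (fun g : X × A => f g.1 g.2) u :=
    fun u => RingQuot.liftAlgHom_mkAlgHom_apply ℂ _ hrel u
  have hgen : ∀ x a, ψ (gen G x a) = f x a := fun x a => by rw [gen, hψ, FreeAlgebra.lift_ι_apply]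
  refine ⟨{ ψ with map_star' := fun t => ?_ }, hgen⟩
  change ψ (star t) = star (ψ t)
  obtain ⟨u, rfl⟩ := mk_surjective G t
  induction u using FreeAlgebra.induction with
  | grade0 c =>
    rw [AlgHom.commutes, ← algebraMap_star_comm, AlgHom.commutes, AlgHom.commutes,
      algebraMap_star_comm]
  | grade1 g => rw [← gen, star_gen, hgen, hstar]
  | mul a b ha hb => rw [map_mul, star_mul, map_mul, map_mul, star_mul, ha, hb]
  | add a b ha hb => rw [map_add, star_add, map_add, map_add, star_add, ha, hb]

end Lift

theorem starAlgHom_surjective {B : Type*} [Ring B] [Algebra ℂ B] [Star B]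
    (φ : B →⋆ₐ[ℂ] GameAlgebra G) (h : ∀ x a, ∃ t, φ t = gen G x a) : Function.Surjective φ := by
  intro t
  obtain ⟨u, rfl⟩ := mk_surjective G t
  induction u using FreeAlgebra.induction with
  | grade0 c => exact ⟨algebraMap ℂ B c, by rw [AlgHomClass.commutes, AlgHomClass.commutes]⟩
  | grade1 g => exact h g.1 g.2
  | mul a b ha hb =>
    obtain ⟨s, hs⟩ := ha
    obtain ⟨t, ht⟩ := hb
    exact ⟨s * t, by rw [map_mul, map_mul, hs, ht]⟩
  | add a b ha hb =>
    obtain ⟨s, hs⟩ := ha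
    obtain ⟨t, ht⟩ := hb
    exact ⟨s + t, by rw [map_add, map_add, hs, ht]⟩

/-- The translation of questions and answers in
`NonlocalGame.HasPerfectQuantumStrategy.of_extendable` on the level of the game algebras. -/
theorem exists_starAlgHom_of_extendable {X' A' : Type*} [Fintype A'] [DecidableEq A']
    {G' : NonlocalGame X' X' A' A'} (hG : G.IsSynchronous) (σ : X' → X) (τ : X' → A → A')
    (hστ : ∀ x y a b, G.Extendable (σ x) (σ y) a b → G'.rule x y (τ x a) (τ y b)) :
    ∃ φ : GameAlgebra G' →⋆ₐ[ℂ] GameAlgebra G,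
      ∀ x a, φ (gen G' x a) = ∑ c with τ x c = a, gen G (σ x) c := by
  refine exists_starAlgHom _ (fun x a => ?_) (fun x a => ?_) (fun x => ?_) fun x y a b h => ?_
  · simp only [star_sum, star_gen]
  · rw [Finset.sum_mul_sum]
    refine Finset.sum_congr rfl fun c hc => ?_
    -- Distinct answers to one question lose by synchronicity, so the generators in a fibre are
    -- mutually orthogonal and their sum is idempotent.
    rw [Finset.sum_eq_single_of_mem c hc, gen_mul_self]
    exact fun d _ hd => gen_mul_gen_eq_zero fun hr => hd (hG _ _ _ hr).symm
  · rw [Finset.sum_fiberwise, sum_gen]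
  · rw [Finset.sum_mul_sum]
    refine Finset.sum_eq_zero fun c hc => Finset.sum_eq_zero fun d hd => ?_
    simp only [Finset.mem_filter, Finset.mem_univ, true_and] at hc hd
    subst hc hd
    exact gen_mul_gen_eq_zero_of_not_extendable (mt (hστ x y c d) h)

end GameAlgebra

/-! ### Extendable pairs in the graph isomorphism game -/

section IsoGame

variable {V₁ V₂ : Type*} {G₁ : SimpleGraph V₁} {G₂ : SimpleGraph V₂}

/-- The relation between two vertices of `G₁` is the same as that between two vertices of `G₂`. -/
def SameVertexRelation (G₁ : SimpleGraph V₁) (G₂ : SimpleGraph V₂) (p q : V₁ × V₂) : Prop :=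
  (p.1 = q.1 ↔ p.2 = q.2) ∧ (G₁.Adj p.1 q.1 ↔ G₂.Adj p.2 q.2)

theorem isoGame_isSynchronous (G₁ : SimpleGraph V₁) (G₂ : SimpleGraph V₂) :
    (isoGame G₁ G₂).IsSynchronous := by
  rintro (x | x) (a | a) (b | b) ⟨p, q, hp, hq, h, -⟩ <;> simp [swapPair] at hp hq <;>
    subst hp hq <;> simpa using h

/-- Further questions may come from either graph; the two kinds give the back and the forth
condition of a back-and-forth argument. -/
theorem exists_sameVertexRelation_of_extendable {x y a b : V₁ ⊕ V₂}
    (h : (isoGame G₁ G₂).Extendable x y a b) :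
    ∃ p q, swapPair x a = some p ∧ swapPair y b = some q ∧ SameVertexRelation G₁ G₂ p q ∧
      (∀ z, ∃ c, SameVertexRelation G₁ G₂ p (z, c) ∧ SameVertexRelation G₁ G₂ (z, c) q) ∧
      ∀ c, ∃ z, SameVertexRelation G₁ G₂ p (z, c) ∧ SameVertexRelation G₁ G₂ (z, c) q := by
  obtain ⟨⟨p, q, hp, hq, hpq⟩, hz⟩ := h
  refine ⟨p, q, hp, hq, hpq, fun z => ?_, fun c => ?_⟩
  · obtain ⟨c, ⟨p', r, hp', hr, h₁⟩, r', q', hr', hq', h₂⟩ := hz (.inl z)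
    rcases c with c | c <;> simp [swapPair] at hr hr'
    rw [hp, Option.some.injEq] at hp'
    rw [hq, Option.some.injEq] at hq'
    subst hr hr' hp' hq'
    exact ⟨c, h₁, h₂⟩
  · obtain ⟨z, ⟨p', r, hp', hr, h₁⟩, r', q', hr', hq', h₂⟩ := hz (.inr c)
    rcases z with z | z <;> simp [swapPair] at hr hr'
    rw [hp, Option.some.injEq] at hp'
    rw [hq, Option.some.injEq] at hq'
    subst hr hr' hp' hq'
    exact ⟨z, h₁, h₂⟩

section Neighborhoods

variable {p q : V₁ × V₂}
  (h₁ : ∀ z, ∃ c, SameVertexRelation G₁ G₂ p (z, c) ∧ SameVertexRelation G₁ G₂ (z, c) q)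
  (h₂ : ∀ c, ∃ z, SameVertexRelation G₁ G₂ p (z, c) ∧ SameVertexRelation G₁ G₂ (z, c) q)

include h₁ h₂

theorem exists_adj_and_adj_iff :
    (∃ z, G₁.Adj p.1 z ∧ G₁.Adj z q.1) ↔ ∃ c, G₂.Adj p.2 c ∧ G₂.Adj c q.2 := by
  constructor
  · rintro ⟨z, hp, hq⟩
    obtain ⟨c, hc, hc'⟩ := h₁ z
    exact ⟨c, hc.2.1 hp, hc'.2.1 hq⟩
  · rintro ⟨c, hp, hq⟩
    obtain ⟨z, hz, hz'⟩ := h₂ c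
    exact ⟨z, hz.2.2 hp, hz'.2.2 hq⟩

theorem neighbors_eq_iff :
    (∀ z, G₁.Adj p.1 z ↔ G₁.Adj q.1 z) ↔ ∀ c, G₂.Adj p.2 c ↔ G₂.Adj q.2 c := by
  constructor
  · intro h c
    obtain ⟨z, hz, hz'⟩ := h₂ c
    rw [← hz.2, G₂.adj_comm, ← hz'.2, G₁.adj_comm z]
    exact h z
  · intro h z
    obtain ⟨c, hc, hc'⟩ := h₁ z
    have := h c
    rw [G₂.adj_comm q.2] at this
    rw [hc.2, G₁.adj_comm, hc'.2]
    exact this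

end Neighborhoods

end IsoGame

/-! ### Neighbourhood hypergraphs and the passage from the graph game -/

namespace SimpleGraph

variable {V : Type*} [Fintype V] [DecidableEq V] [Nonempty V] (G : SimpleGraph V)
  [DecidableRel G.Adj]

/-- The neighbourhood of a vertex as an edge of the neighbourhood hypergraph. -/
def neighborEdge (v : V) : G.neighborhoodHypergraph.Edge :=
  ⟨G.neighborFinset v, Finset.mem_image_of_mem _ (Finset.mem_univ v)⟩

theorem neighborEdge_surjective : Function.Surjective G.neighborEdge := by
  rintro ⟨e, he⟩
  obtain ⟨v, -, hv⟩ := Finset.mem_image.1 he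
  exact ⟨v, Subtype.ext hv⟩

theorem mem_neighborEdge {v w : V} : w ∈ (G.neighborEdge v).1 ↔ G.Adj v w :=
  G.mem_neighborFinset v w

theorem neighborEdge_eq_iff {v w : V} :
    G.neighborEdge v = G.neighborEdge w ↔ ∀ z, G.Adj v z ↔ G.Adj w z := by
  rw [Subtype.ext_iff, Finset.ext_iff]
  exact forall_congr' fun z => by rw [mem_neighborEdge, mem_neighborEdge]

theorem neighborhoodHypergraph_adj {v w : V} :
    G.neighborhoodHypergraph.Adj v w ↔ ∃ z, G.Adj v z ∧ G.Adj z w := by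
  constructor
  · rintro ⟨e, he, hv, hw⟩
    obtain ⟨z, hz⟩ := G.neighborEdge_surjective ⟨e, he⟩
    obtain rfl : (G.neighborEdge z).1 = e := by rw [hz]
    exact ⟨z, (G.mem_neighborEdge.1 hv).symm, G.mem_neighborEdge.1 hw⟩
  · rintro ⟨z, hv, hw⟩
    exact ⟨_, (G.neighborEdge z).2, G.mem_neighborEdge.2 hv.symm, G.mem_neighborEdge.2 hw⟩

/-- A vertex with the given neighbourhood. -/
noncomputable def edgeRep (e : G.neighborhoodHypergraph.Edge) : V :=
  (G.neighborEdge_surjective e).choose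

theorem neighborEdge_edgeRep (e : G.neighborhoodHypergraph.Edge) :
    G.neighborEdge (G.edgeRep e) = e :=
  (G.neighborEdge_surjective e).choose_spec

end SimpleGraph

section NeighborhoodGame

variable {V₁ V₂ : Type*} [Fintype V₁] [DecidableEq V₁] [Nonempty V₁]
  [Fintype V₂] [DecidableEq V₂] [Nonempty V₂]
  (G₁ : SimpleGraph V₁) [DecidableRel G₁.Adj] (G₂ : SimpleGraph V₂) [DecidableRel G₂.Adj]

open FiniteHypergraph

/-- The question of the graph isomorphism game asked in place of a question of the game of the
neighbourhood hypergraphs. -/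
noncomputable def questionRep :
    Question G₁.neighborhoodHypergraph G₂.neighborhoodHypergraph → V₁ ⊕ V₂
  | .inl x => x
  | .inr x => x.map G₁.edgeRep G₂.edgeRep

/-- The answer in the game of the neighbourhood hypergraphs obtained from an answer in the graph
isomorphism game. -/
def answerMap : Question G₁.neighborhoodHypergraph G₂.neighborhoodHypergraph → V₁ ⊕ V₂ →
    Question G₁.neighborhoodHypergraph G₂.neighborhoodHypergraph
  | .inl _, a => .inl a
  | .inr _, a => .inr (a.map G₁.neighborEdge G₂.neighborEdge)

/-- A pair of vertices, or the pair of their neighbourhoods. -/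
def typedNeighbors (b : Bool) (p : V₁ × V₂) :
    (V₁ × V₂) ⊕ (G₁.neighborhoodHypergraph.Edge × G₂.neighborhoodHypergraph.Edge) :=
  if b then .inl p else .inr (G₁.neighborEdge p.1, G₂.neighborEdge p.2)

theorem typedPair_answerMap
    (x : Question G₁.neighborhoodHypergraph G₂.neighborhoodHypergraph) {a : V₁ ⊕ V₂} {p : V₁ × V₂}
    (h : swapPair (questionRep G₁ G₂ x) a = some p) :
    typedPair _ _ x (answerMap G₁ G₂ x a) = some (typedNeighbors G₁ G₂ x.isLeft p) := by
  rcases x with x | (e | e)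
  · simp only [questionRep] at h
    simp [answerMap, typedPair, typedNeighbors, h]
  all_goals
    rcases a with a | a <;> simp [questionRep, swapPair] at h
    subst h
    simp [answerMap, typedPair, swapPair, typedNeighbors, SimpleGraph.neighborEdge_edgeRep]

/-- Each hypergraph relation has a graph meaning: incidence is adjacency, lying in a common edge and
intersecting are both the existence of a two-step walk, and equality of edges is equality of
neighbourhoods. The last three involve a third vertex and use extendability. -/
theorem hypIsoGame_rule_of_extendable
    (x y : Question G₁.neighborhoodHypergraph G₂.neighborhoodHypergraph) (a b : V₁ ⊕ V₂)
    (h : (isoGame G₁ G₂).Extendable (questionRep G₁ G₂ x) (questionRep G₁ G₂ y) a b) :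
    (hypIsoGame G₁.neighborhoodHypergraph G₂.neighborhoodHypergraph).rule x y
      (answerMap G₁ G₂ x a) (answerMap G₁ G₂ y b) := by
  obtain ⟨p, q, hp, hq, hpq, h₁, h₂⟩ := exists_sameVertexRelation_of_extendable h
  refine ⟨_, _, typedPair_answerMap G₁ G₂ x hp, typedPair_answerMap G₁ G₂ y hq, ?_⟩
  -- Only the types of the two questions matter now; `false` stands for an edge, so the edge–edge
  -- case comes first.
  rcases x.isLeft <;> rcases y.isLeft
  · refine ⟨?_, fun _ => ?_⟩
    · rw [G₁.neighborEdge_eq_iff, G₂.neighborEdge_eq_iff]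
      exact neighbors_eq_iff h₁ h₂
    · simp only [SimpleGraph.mem_neighborEdge]
      simpa only [G₁.adj_comm q.1, G₂.adj_comm q.2] using exists_adj_and_adj_iff h₁ h₂
  · exact G₁.mem_neighborEdge.trans (hpq.2.trans G₂.mem_neighborEdge.symm)
  · refine G₁.mem_neighborEdge.trans (Iff.trans ?_ G₂.mem_neighborEdge.symm)
    simpa [G₁.adj_comm q.1, G₂.adj_comm q.2] using hpq.2
  · refine ⟨hpq.1, fun _ => ?_⟩
    rw [G₁.neighborhoodHypergraph_adj, G₂.neighborhoodHypergraph_adj]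
    exact exists_adj_and_adj_iff h₁ h₂

theorem quantumIsomorphic_neighborhoodHypergraph
    (h : (isoGame G₁ G₂).HasPerfectQuantumStrategy) :
    G₁.neighborhoodHypergraph.QuantumIsomorphic G₂.neighborhoodHypergraph :=
  h.of_extendable (isoGame_isSynchronous G₁ G₂) _ _ (hypIsoGame_rule_of_extendable G₁ G₂)

/-- On vertex questions the translation of answers is injective, so each fibre sum is a single
generator. Hence all generators of the target are hit. -/
theorem exists_surjective_starAlgHom_neighborhoodHypergraph :
    ∃ φ : GameAlgebra (G₁.neighborhoodHypergraph.hypIsoGame G₂.neighborhoodHypergraph) →⋆ₐ[ℂ]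
        GameAlgebra (isoGame G₁ G₂), Function.Surjective φ ∧
      ∀ v₁ v₂, φ (GameAlgebra.gen _ (.inl (.inl v₁)) (.inl (.inr v₂))) =
        GameAlgebra.gen _ (.inl v₁) (.inr v₂) := by
  obtain ⟨φ, hφ⟩ := GameAlgebra.exists_starAlgHom_of_extendable (isoGame_isSynchronous G₁ G₂)
    _ _ (hypIsoGame_rule_of_extendable G₁ G₂)
  have h : ∀ x a, φ (GameAlgebra.gen _ (.inl x) (.inl a)) = GameAlgebra.gen _ x a := by
    intro x a
    rw [hφ]
    simp only [answerMap, questionRep, Sum.inl.injEq]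
    rw [Finset.filter_eq', if_pos (Finset.mem_univ a), Finset.sum_singleton]
  exact ⟨φ, GameAlgebra.starAlgHom_surjective φ fun x a => ⟨_, h x a⟩, fun _ _ => h _ _⟩

end NeighborhoodGame

/-! ### Strategies from the maximally entangled state -/

section MaximallyEntangled

theorem inner_ofReal_smul_smul {H : Type*} [NormedAddCommGroup H] [InnerProductSpace ℂ H] (c : ℝ)
    (v w : H) : inner ℂ ((c : ℂ) • v) ((c : ℂ) • w) = c * c * inner ℂ v w := by
  rw [inner_smul_left, inner_smul_right, Complex.conj_ofReal, mul_assoc]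

variable {n : Type*} [Fintype n] [DecidableEq n]

/-- The unnormalized maximally entangled vector. -/
noncomputable def entangledVector (n : Type*) [Fintype n] [DecidableEq n] :
    EuclideanSpace ℂ n ⊗[ℂ] EuclideanSpace ℂ n :=
  ∑ i, EuclideanSpace.single i 1 ⊗ₜ EuclideanSpace.single i 1

/-- The right-hand side is the trace of `S` times the transpose of `T`. For symmetric `T` it is the
trace of `S * T`, so vanishing products give vanishing probabilities. -/
theorem inner_entangledVector_map (S T : Matrix n n ℂ) :
    inner ℂ (entangledVector n)
      (TensorProduct.map S.toEuclideanLin T.toEuclideanLin (entangledVector n)) =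
      ∑ i, ∑ j, S i j * T i j := by
  simp only [entangledVector, map_sum, TensorProduct.map_tmul, sum_inner, inner_sum,
    TensorProduct.inner_tmul]
  simpa [EuclideanSpace.inner_single_left] using Finset.sum_comm

theorem entangledVector_ne_zero [Nonempty n] : entangledVector n ≠ 0 := by
  intro h
  have := inner_entangledVector_map (1 : Matrix n n ℂ) 1
  rw [h, map_zero, inner_zero_left] at this
  simp [Matrix.one_apply, eq_comm] at this

end MaximallyEntangled

namespace NonlocalGame

open scoped ComplexOrder in
/-- A family of real symmetric projections satisfying the relations of the game algebra yields a
perfect quantum strategy. -/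
theorem HasPerfectQuantumStrategy.of_matrix {X A : Type*} [Fintype A] {G : NonlocalGame X X A A}
    {n : Type} [Fintype n] [DecidableEq n] [Nonempty n] (P : X → A → Matrix n n ℝ)
    (hsymm : ∀ x a, (P x a).transpose = P x a) (hidem : ∀ x a, P x a * P x a = P x a)
    (hsum : ∀ x, ∑ a, P x a = 1) (hlose : ∀ x y a b, ¬ G.rule x y a b → P x a * P y b = 0) :
    G.HasPerfectQuantumStrategy := by
  let E : X → A → (EuclideanSpace ℂ n →ₗ[ℂ] EuclideanSpace ℂ n) :=
    fun x a => ((P x a).map (algebraMap ℝ ℂ)).toEuclideanLin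
  have hE : ∀ x, IsPOVM (E x) := by
    refine fun x => ⟨fun a => ?_, ?_⟩
    · rw [Matrix.isPositive_toEuclideanLin_iff]
      have h : (P x a).map (algebraMap ℝ ℂ) = ((P x a).map (algebraMap ℝ ℂ)).conjTranspose *
          (P x a).map (algebraMap ℝ ℂ) := by
        have h₁ : ((P x a).map (algebraMap ℝ ℂ)).conjTranspose = (P x a).map (algebraMap ℝ ℂ) := by
          ext i j
          simpa using congrFun (congrFun (hsymm x a) i) j
        rw [h₁, ← Matrix.map_mul, hidem]
      rw [h]
      exact Matrix.posSemidef_conjTranspose_mul_self _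
    · have h := congrArg (fun M => (M.map (algebraMap ℝ ℂ)).toEuclideanLin) (hsum x)
      have h₁ : (Matrix.toEuclideanLin (1 : Matrix n n ℂ)) = LinearMap.id := by
        ext; simp
      simp only [Matrix.map_one _ (map_zero (algebraMap ℝ ℂ)) (map_one _), h₁] at h
      rw [← h, ← RingHom.mapMatrix_apply, map_sum, map_sum]
      rfl
  let c : ℝ := ‖entangledVector n‖⁻¹
  have hc : ‖(c : ℂ) • entangledVector n‖ = 1 := by
    rw [Complex.ofReal_inv]
    exact norm_smul_inv_norm entangledVector_ne_zero
  have hinner : ∀ x y a b, (((c * c) * (P x a * P y b).trace : ℝ) : ℂ) =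
      inner ℂ ((c : ℂ) • entangledVector n)
        (TensorProduct.map (E x a) (E y b) ((c : ℂ) • entangledVector n)) := by
    intro x y a b
    rw [map_smul]
    refine Eq.trans ?_ (inner_ofReal_smul_smul (H := EuclideanSpace ℂ n ⊗[ℂ] EuclideanSpace ℂ n)
      c _ _).symm
    rw [inner_entangledVector_map, Complex.ofReal_mul, Complex.ofReal_mul, Matrix.trace,
      Complex.ofReal_sum]
    refine congrArg _ (Finset.sum_congr rfl fun i _ => ?_)
    rw [Matrix.diag_apply, Matrix.mul_apply, Complex.ofReal_sum]
    refine Finset.sum_congr rfl fun j _ => ?_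
    simp [← congrFun (congrFun (hsymm y b) i) j]
  refine ⟨fun x y a b => (c * c) * (P x a * P y b).trace, ⟨EuclideanSpace ℂ n, EuclideanSpace ℂ n,
    _, _, inferInstance, _, _, inferInstance, _, E, E, hc, hE, hE, hinner⟩, fun x y a b hr => ?_⟩
  simp only [hlose x y a b hr, Matrix.trace_zero, mul_zero]

end NonlocalGame

/-! ### Quantum isomorphism of a constraint system graph with its homogenization -/

namespace BCS

variable {ι κ : Type*} (F : BCS ι κ)

/-- The sum of a satisfying assignment and a solution of the homogeneous constraint. -/
def satAdd {l : κ} (a : F.Sat l) (c : F.homogenization.Sat l) : F.Sat l :=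
  ⟨fun i => a.1 i + c.1 i, (Finset.sum_add_distrib (f := a.1) (g := c.1)).trans
    ((congrArg₂ (· + ·) a.2 c.2).trans (add_zero _))⟩

theorem satAdd_bijective_right {l : κ} (a : F.Sat l) :
    Function.Bijective fun c => F.satAdd a c := by
  refine ⟨fun c d h => Subtype.ext <| funext fun i => ?_, fun b => ?_⟩
  · exact add_left_cancel (congrFun (congrArg Subtype.val h) i)
  · refine ⟨⟨fun i => b.1 i - a.1 i, ?_⟩, Subtype.ext <| funext fun i => add_sub_cancel _ _⟩
    exact (Finset.sum_sub_distrib b.1 a.1).trans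
      ((congrArg₂ (· - ·) b.2 a.2).trans (sub_self _))

theorem satAdd_bijective_left {l : κ} (c : F.homogenization.Sat l) :
    Function.Bijective fun a => F.satAdd a c := by
  refine ⟨fun a b h => Subtype.ext <| funext fun i => ?_, fun b => ?_⟩
  · exact add_right_cancel (congrFun (congrArg Subtype.val h) i)
  · refine ⟨⟨fun i => b.1 i - c.1 i, ?_⟩, Subtype.ext <| funext fun i => sub_add_cancel _ _⟩
    exact (Finset.sum_sub_distrib b.1 c.1).trans
      ((congrArg₂ (· - ·) b.2 c.2).trans (sub_zero _))

variable {F} {n : Type} [DecidableEq κ]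

/-- The entry of the quantum permutation matrix that sends `u` to `v`. -/
def pairMatrix (E : F.Vertex → Matrix n n ℝ) (u : F.Vertex) (v : F.homogenization.Vertex) :
    Matrix n n ℝ :=
  if h : u.1 = v.1 then E ⟨v.1, F.satAdd (h ▸ u.2) v.2⟩ else 0

theorem pairMatrix_self (E : F.Vertex → Matrix n n ℝ) {l : κ} (a : F.Sat l)
    (c : F.homogenization.Sat l) : pairMatrix E ⟨l, a⟩ ⟨l, c⟩ = E ⟨l, F.satAdd a c⟩ := by
  simp [pairMatrix]

theorem pairMatrix_of_ne (E : F.Vertex → Matrix n n ℝ) {k l : κ} (h : k ≠ l) (a : F.Sat k)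
    (c : F.homogenization.Sat l) : pairMatrix E ⟨k, a⟩ ⟨l, c⟩ = 0 := by
  simp [pairMatrix, h]

/-- If the product does not vanish, the assignments `a + c` and `b + d` agree on all shared
variables. There `a` and `b` agree exactly where `c` and `d` do, which preserves both equality and
adjacency. -/
theorem pairMatrix_mul_eq_zero [Fintype n] {E : F.Vertex → Matrix n n ℝ}
    (hadj : ∀ u v, F.graph.Adj u v → E u * E v = 0) (p q : F.Vertex × F.homogenization.Vertex)
    (h : ¬ SameVertexRelation F.graph F.homogenization.graph p q) :
    pairMatrix E p.1 p.2 * pairMatrix E q.1 q.2 = 0 := by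
  obtain ⟨⟨l, a⟩, l', c⟩ := p
  obtain ⟨⟨k, b⟩, k', d⟩ := q
  by_cases hl : l = l'
  swap
  · rw [pairMatrix_of_ne E hl, zero_mul]
  by_cases hk : k = k'
  swap
  · rw [pairMatrix_of_ne E hk, mul_zero]
  subst hl hk
  rw [pairMatrix_self, pairMatrix_self]
  refine hadj _ _ ?_
  by_contra hn
  have hi : ∀ i (hi : i ∈ F.support l) (hj : i ∈ F.support k),
      a.1 ⟨i, hi⟩ + c.1 ⟨i, hi⟩ = b.1 ⟨i, hj⟩ + d.1 ⟨i, hj⟩ :=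
    fun i hi hj => not_not.1 fun h' => hn ⟨i, hi, hj, h'⟩
  have hiff : ∀ i (hi : i ∈ F.support l) (hj : i ∈ F.support k),
      a.1 ⟨i, hi⟩ = b.1 ⟨i, hj⟩ ↔ c.1 ⟨i, hi⟩ = d.1 ⟨i, hj⟩ := by
    intro i h₁ h₂
    have := hi i h₁ h₂
    exact ⟨fun h' => by rwa [h', add_right_inj] at this,
      fun h' => by rwa [h', add_left_inj] at this⟩
  refine h ⟨?_, ?_⟩
  · constructor
    · intro he
      obtain rfl : l = k := congrArg Sigma.fst he
      obtain rfl : a = b := by simpa using he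
      obtain rfl : c = d := Subtype.ext <| funext fun i => (hiff i.1 i.2 i.2).1 rfl
      rfl
    · intro he
      obtain rfl : l = k := congrArg Sigma.fst he
      obtain rfl : c = d := by simpa using he
      obtain rfl : a = b := Subtype.ext <| funext fun i => (hiff i.1 i.2 i.2).2 rfl
      rfl
  · exact exists_congr fun i => exists_congr fun h₁ => exists_congr fun h₂ =>
      not_congr (hiff i h₁ h₂)

variable [DecidableEq n] [DecidableEq ι] [Fintype κ]

/-- For fixed `a`, the sums `a + c` run once through the satisfying assignments of the same
constraint. -/
theorem sum_pairMatrix_right {E : F.Vertex → Matrix n n ℝ}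
    (hsum : ∀ l, ∑ a, E ⟨l, a⟩ = 1) (u : F.Vertex) :
    ∑ v, pairMatrix E u v = 1 := by
  obtain ⟨l, a⟩ := u
  rw [Fintype.sum_sigma, Finset.sum_eq_single l]
  · rw [← hsum l, ← (F.satAdd_bijective_right a).sum_comp fun a => E ⟨l, a⟩]
    exact Finset.sum_congr rfl fun c _ => pairMatrix_self E a c
  · exact fun k _ hk => Finset.sum_eq_zero fun c _ => pairMatrix_of_ne E hk.symm a c
  · simp

theorem sum_pairMatrix_left {E : F.Vertex → Matrix n n ℝ}
    (hsum : ∀ l, ∑ a, E ⟨l, a⟩ = 1) (v : F.homogenization.Vertex) :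
    ∑ u, pairMatrix E u v = 1 := by
  obtain ⟨l, c⟩ := v
  rw [Fintype.sum_sigma, Finset.sum_eq_single l]
  · rw [← hsum l, ← (F.satAdd_bijective_left c).sum_comp fun a => E ⟨l, a⟩]
    exact Finset.sum_congr rfl fun a _ => pairMatrix_self E a c
  · exact fun k _ hk => Finset.sum_eq_zero fun a _ => pairMatrix_of_ne E hk a c
  · simp

/-- Projections onto the joint eigenspaces of an operator solution make the graph of a binary
constraint system quantum isomorphic to that of its homogenization. -/
theorem hasPerfectQuantumStrategy_isoGame_homogenization [Fintype n] [Nonempty n]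
    {E : F.Vertex → Matrix n n ℝ} (hsymm : ∀ u, (E u).transpose = E u)
    (hidem : ∀ u, E u * E u = E u) (hsum : ∀ l, ∑ a, E ⟨l, a⟩ = 1)
    (hadj : ∀ u v, F.graph.Adj u v → E u * E v = 0) :
    (isoGame F.graph F.homogenization.graph).HasPerfectQuantumStrategy := by
  have hPsymm : ∀ u v, (pairMatrix E u v).transpose = pairMatrix E u v := by
    intro u v
    unfold pairMatrix
    split_ifs
    exacts [hsymm _, Matrix.transpose_zero]
  have hPidem : ∀ u v, pairMatrix E u v * pairMatrix E u v = pairMatrix E u v := by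
    intro u v
    unfold pairMatrix
    split_ifs
    exacts [hidem _, mul_zero _]
  refine .of_matrix
    (fun x a => (swapPair x a).elim 0 fun p => pairMatrix E p.1 p.2) ?_ ?_ ?_ ?_
  · intro x a
    rcases swapPair x a with - | p
    exacts [Matrix.transpose_zero, hPsymm _ _]
  · intro x a
    rcases swapPair x a with - | p
    exacts [mul_zero _, hPidem _ _]
  · rintro (u | v)
    · simpa [swapPair] using sum_pairMatrix_right hsum u
    · simpa [swapPair] using sum_pairMatrix_left hsum v
  · intro x y a b hr
    rcases hp : swapPair x a with - | p
    · exact zero_mul _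
    rcases hq : swapPair y b with - | q
    · exact mul_zero _
    exact pairMatrix_mul_eq_zero hadj p q fun h => hr ⟨p, q, hp, hq, h⟩

end BCS

/-! ### The Mermin–Peres projections -/

namespace BCS

/-- The Mermin-Peres observables: an operator solution of the magic square. -/
def magicObservable : Fin 3 × Fin 3 → Matrix (Fin 4) (Fin 4) ℤ
  | (0, 0) => !![0, 0, 1, 0; 0, 0, 0, 1; 1, 0, 0, 0; 0, 1, 0, 0]
  | (0, 1) => !![0, 1, 0, 0; 1, 0, 0, 0; 0, 0, 0, 1; 0, 0, 1, 0]
  | (0, 2) => !![0, 0, 0, 1; 0, 0, 1, 0; 0, 1, 0, 0; 1, 0, 0, 0]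
  | (1, 0) => !![1, 0, 0, 0; 0, -1, 0, 0; 0, 0, 1, 0; 0, 0, 0, -1]
  | (1, 1) => !![1, 0, 0, 0; 0, 1, 0, 0; 0, 0, -1, 0; 0, 0, 0, -1]
  | (1, 2) => !![1, 0, 0, 0; 0, -1, 0, 0; 0, 0, -1, 0; 0, 0, 0, 1]
  | (2, 0) => !![0, 0, 1, 0; 0, 0, 0, -1; 1, 0, 0, 0; 0, -1, 0, 0]
  | (2, 1) => !![0, 1, 0, 0; 1, 0, 0, 0; 0, 0, 0, -1; 0, 0, -1, 0]
  | (2, 2) => !![0, 0, 0, -1; 0, 0, 1, 0; 0, 1, 0, 0; -1, 0, 0, 0]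

/-- The eigenvalue `(-1) ^ a`. -/
def signOf (a : ZMod 2) : ℤ := if a = 0 then 1 else -1

/-- Four times the projection onto the joint eigenspace with the eigenvalues prescribed by `u`. -/
def magicEigenmatrix (u : magicSquare.Vertex) : Matrix (Fin 4) (Fin 4) ℤ :=
  1 + ∑ i, signOf (u.2.1 i) • magicObservable i

theorem signOf_mul_self : ∀ a, signOf a * signOf a = 1 := by decide

theorem signOf_sub_ne_zero : ∀ a b, a ≠ b → signOf a - signOf b ≠ 0 := by decide

theorem transpose_magicObservable :
    ∀ i, (magicObservable i).transpose = magicObservable i := by decide +kernel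

/-- The three observables of a constraint commute, square to one, and multiply to the sign of its
parity. So for a satisfying assignment with signs `s` one has `s₁s₂A₁A₂ = s₃A₃`, and `1 + s₁A₁ +
s₂A₂ + s₃A₃` equals `(1 + s₁A₁)(1 + s₂A₂)`, which absorbs each observable. -/
theorem magicEigenmatrix_mul_magicObservable : ∀ u i,
    magicEigenmatrix u * magicObservable i.1 = signOf (u.2.1 i) • magicEigenmatrix u := by
  decide +kernel

/-- Among the four satisfying assignments each variable takes both values twice, so the observables
cancel. -/
theorem sum_magicEigenmatrix : ∀ l, ∑ a, magicEigenmatrix ⟨l, a⟩ = 4 • 1 := by decide +kernel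

theorem card_magicSquare_support : ∀ l, Fintype.card (magicSquare.support l) = 3 := by decide

theorem transpose_magicEigenmatrix (u : magicSquare.Vertex) :
    (magicEigenmatrix u).transpose = magicEigenmatrix u := by
  simp only [magicEigenmatrix, Matrix.transpose_add, Matrix.transpose_one, Matrix.transpose_sum,
    Matrix.transpose_smul, transpose_magicObservable]

theorem magicObservable_mul_magicEigenmatrix (u : magicSquare.Vertex)
    (i : magicSquare.support u.1) :
    magicObservable i.1 * magicEigenmatrix u = signOf (u.2.1 i) • magicEigenmatrix u := by
  have h := congrArg Matrix.transpose (magicEigenmatrix_mul_magicObservable u i)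
  rwa [Matrix.transpose_mul, Matrix.transpose_smul, transpose_magicObservable,
    transpose_magicEigenmatrix] at h

/-- Expanding one factor, the identity and each of the three signed observables act on the other
factor as `1`, which gives the factor `1 + 3`. -/
theorem magicEigenmatrix_mul_self (u : magicSquare.Vertex) :
    magicEigenmatrix u * magicEigenmatrix u = 4 • magicEigenmatrix u := by
  have h : magicEigenmatrix u = 1 + ∑ i, signOf (u.2.1 i) • magicObservable i := rfl
  nth_rewrite 1 [h]
  rw [add_mul, one_mul, Finset.sum_mul]
  simp only [smul_mul_assoc, magicObservable_mul_magicEigenmatrix, smul_smul, signOf_mul_self,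
    one_smul, Finset.sum_const, Finset.card_univ, card_magicSquare_support]
  module

/-- Eigenspaces for different eigenvalues are orthogonal: the observable of a conflicting variable,
placed between the factors, can be absorbed on either side with opposite signs. -/
theorem magicEigenmatrix_mul_eq_zero {u v : magicSquare.Vertex}
    (h : magicSquare.graph.Adj u v) : magicEigenmatrix u * magicEigenmatrix v = 0 := by
  obtain ⟨i, hu, hv, hne⟩ := h
  have h₁ : magicEigenmatrix u * magicObservable i * magicEigenmatrix v =
      signOf (u.2.1 ⟨i, hu⟩) • (magicEigenmatrix u * magicEigenmatrix v) := by
    rw [magicEigenmatrix_mul_magicObservable u ⟨i, hu⟩, smul_mul_assoc]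
  rw [mul_assoc, magicObservable_mul_magicEigenmatrix v ⟨i, hv⟩, mul_smul_comm, ← sub_eq_zero,
    ← sub_smul] at h₁
  exact (smul_eq_zero.1 h₁).resolve_left (signOf_sub_ne_zero _ _ hne.symm)

theorem magicSquare_hasPerfectQuantumStrategy :
    (isoGame magicSquare.graph magicSquare.homogenization.graph).HasPerfectQuantumStrategy := by
  let f : Matrix (Fin 4) (Fin 4) ℤ →+* Matrix (Fin 4) (Fin 4) ℝ := (Int.castRingHom ℝ).mapMatrix
  refine hasPerfectQuantumStrategy_isoGame_homogenization
    (E := fun u => (4⁻¹ : ℝ) • f (magicEigenmatrix u)) (fun u => ?_) (fun u => ?_) (fun l => ?_)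
    fun u v h => ?_
  · rw [Matrix.transpose_smul, RingHom.mapMatrix_apply, ← Matrix.transpose_map,
      transpose_magicEigenmatrix]
  · rw [smul_mul_smul_comm, ← map_mul, magicEigenmatrix_mul_self, map_nsmul]
    module
  · rw [← Finset.smul_sum, ← map_sum, sum_magicEigenmatrix, map_nsmul, map_one]
    module
  · rw [smul_mul_smul_comm, ← map_mul, magicEigenmatrix_mul_eq_zero h, map_zero, smul_zero]

end BCS

/-! ### Local strategies and hypergraph isomorphisms -/

theorem exists_pos_of_sum_eq_one {ι : Type*} [Fintype ι] {t : ι → ℝ} (h : ∑ i, t i = 1) :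
    ∃ i, 0 < t i := by
  by_contra! hn
  linarith [Finset.sum_nonpos fun i (_ : i ∈ Finset.univ) => hn i]

/-- Fix a product of positive weight and, for every question, an answer of positive probability in
it. Such answers occur together with positive probability, so they cannot lose. -/
theorem NonlocalGame.HasPerfectLocalStrategy.exists_deterministic {X Y A B : Type*} [Fintype A]
    [Fintype B] {G : NonlocalGame X Y A B} (h : G.HasPerfectLocalStrategy) :
    ∃ (f : X → A) (g : Y → B), ∀ x y, G.rule x y (f x) (g y) := by
  obtain ⟨p, ⟨k, w, r, s, hw, hw1, hr, hs, hp⟩, hperf⟩ := h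
  have hA := fun (i : Fin k) x => exists_pos_of_sum_eq_one (hr i x).2
  have hB := fun (i : Fin k) y => exists_pos_of_sum_eq_one (hs i y).2
  obtain ⟨i, hi⟩ := exists_pos_of_sum_eq_one hw1
  choose f hf using hA i
  choose g hg using hB i
  refine ⟨f, g, fun x y => ?_⟩
  by_contra hn
  have h0 := hperf x y _ _ hn
  rw [hp, Finset.sum_eq_zero_iff_of_nonneg fun j _ =>
    mul_nonneg (hw j) (mul_nonneg ((hr j x).1 _) ((hs j y).1 _))] at h0
  exact (mul_pos hi (mul_pos (hf x) (hg y))).ne' (h0 i (Finset.mem_univ i))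

namespace FiniteHypergraph

variable {V₁ V₂ : Type*} {Λ₁ : FiniteHypergraph V₁} {Λ₂ : FiniteHypergraph V₂}

theorem sameRelation_of_rule {x y a b : Question Λ₁ Λ₂} {P Q : (V₁ × V₂) ⊕ (Λ₁.Edge × Λ₂.Edge)}
    (h : (hypIsoGame Λ₁ Λ₂).rule x y a b) (hP : typedPair Λ₁ Λ₂ x a = some P)
    (hQ : typedPair Λ₁ Λ₂ y b = some Q) :
    SameRelation Λ₁ Λ₂ P Q := by
  obtain ⟨P', Q', hP', hQ', h⟩ := h
  rw [hP, Option.some.injEq] at hP'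
  rw [hQ, Option.some.injEq] at hQ'
  rwa [hP', hQ']

/-- The first player's map `F` on `V₁` and the second player's map `F'` on `V₂` are mutually inverse
by the equality relation. Incidence identifies the second player's edge answers `Φ` and `Φ'` with
image and preimage under `F`. -/
theorem LocIsomorphic.isIsomorphic [Fintype V₁] [Fintype V₂] (h : Λ₁.LocIsomorphic Λ₂) :
    Λ₁.IsIsomorphic Λ₂ := by
  obtain ⟨f, g, h⟩ := h.exists_deterministic
  have hF : ∀ v, ∃ w, f (.inl (.inl v)) = .inl (.inr w) := by
    intro v
    obtain ⟨P, Q, hP, -⟩ := h (.inl (.inl v)) (.inl (.inl v))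
    rcases hf : f (.inl (.inl v)) with (a | a) | a <;> simp [hf, typedPair, swapPair] at hP ⊢
  have hF' : ∀ v, ∃ w, g (.inl (.inr v)) = .inl (.inl w) := by
    intro v
    obtain ⟨P, Q, -, hQ, -⟩ := h (.inl (.inr v)) (.inl (.inr v))
    rcases hf : g (.inl (.inr v)) with (a | a) | a <;> simp [hf, typedPair, swapPair] at hQ ⊢
  have hΦ : ∀ v, ∃ w, g (.inr (.inl v)) = .inr (.inr w) := by
    intro v
    obtain ⟨P, Q, -, hQ, -⟩ := h (.inr (.inl v)) (.inr (.inl v))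
    rcases hf : g (.inr (.inl v)) with a | (a | a) <;> simp [hf, typedPair, swapPair] at hQ ⊢
  have hΦ' : ∀ v, ∃ w, g (.inr (.inr v)) = .inr (.inl w) := by
    intro v
    obtain ⟨P, Q, -, hQ, -⟩ := h (.inr (.inr v)) (.inr (.inr v))
    rcases hf : g (.inr (.inr v)) with a | (a | a) <;> simp [hf, typedPair, swapPair] at hQ ⊢
  choose F hF using hF
  choose F' hF' using hF'
  choose Φ hΦ using hΦ
  choose Φ' hΦ' using hΦ'
  have h₁ : ∀ v w, v = F' w ↔ F v = w := by
    intro v w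
    have := h (.inl (.inl v)) (.inl (.inr w))
    rw [hF, hF'] at this
    exact (sameRelation_of_rule (P := .inl (v, F v)) (Q := .inl (F' w, w)) this rfl rfl).1
  have h₂ : ∀ v e, v ∈ e.1 ↔ F v ∈ (Φ e).1 := by
    intro v e
    have := h (.inl (.inl v)) (.inr (.inl e))
    rw [hF, hΦ] at this
    exact sameRelation_of_rule (P := .inl (v, F v)) (Q := .inr (e, Φ e)) this rfl rfl
  have h₃ : ∀ v e, v ∈ (Φ' e).1 ↔ F v ∈ e.1 := by
    intro v e
    have := h (.inl (.inl v)) (.inr (.inr e))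
    rw [hF, hΦ'] at this
    exact sameRelation_of_rule (P := .inl (v, F v)) (Q := .inr (Φ' e, e)) this rfl rfl
  let f : V₁ ≃ V₂ := ⟨F, F', fun v => ((h₁ v _).2 rfl).symm, fun w => (h₁ _ w).1 rfl⟩
  refine ⟨f, fun e => ⟨fun he => ?_, fun he => ?_⟩⟩
  · convert (Φ ⟨_, he⟩).2
    ext w
    obtain ⟨v, rfl⟩ := f.surjective w
    refine Iff.trans ?_ (h₂ v ⟨_, he⟩)
    simp
  · convert (Φ' ⟨e, he⟩).2
    ext v
    refine Iff.trans ?_ (h₃ v ⟨_, he⟩).symm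
    rw [Finset.mem_map_equiv, Equiv.symm_symm]
    rfl

/-- The number of edges that contain two given vertices. -/
def codegree [DecidableEq V₁] (Λ : FiniteHypergraph V₁) (v w : V₁) : ℕ :=
  (Λ.edges.filter fun e => v ∈ e ∧ w ∈ e).card

theorem IsIsomorphic.exists_equiv_codegree_eq [DecidableEq V₁] [DecidableEq V₂]
    (h : Λ₁.IsIsomorphic Λ₂) :
    ∃ f : V₁ ≃ V₂, ∀ v w, Λ₁.codegree v w = Λ₂.codegree (f v) (f w) := by
  obtain ⟨f, hf⟩ := h
  have hback : ∀ e : Finset V₁, (e.map f.toEmbedding).map f.symm.toEmbedding = e := by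
    intro e
    ext v
    simp
  have hforth : ∀ e : Finset V₂, (e.map f.symm.toEmbedding).map f.toEmbedding = e := by
    intro e
    ext v
    simp
  refine ⟨f, fun v w => Finset.card_nbij' (fun e => e.map f.toEmbedding)
    (fun e => e.map f.symm.toEmbedding) ?_ ?_ (fun e _ => hback e) (fun e _ => hforth e)⟩
  · intro e he
    simp only [Finset.mem_coe, Finset.mem_filter] at he ⊢
    exact ⟨by rw [← hf, hback]; exact he.1, by simpa using he.2⟩
  · intro e he
    simp only [Finset.mem_coe, Finset.mem_filter] at he ⊢
    exact ⟨(hf e).2 he.1, by simpa using he.2⟩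

end FiniteHypergraph

/-! ### Codegrees and isomorphisms of neighbourhood hypergraphs -/

namespace SimpleGraph

variable {V : Type*} [Fintype V] [DecidableEq V] [Nonempty V] (G : SimpleGraph V)
  [DecidableRel G.Adj]

/-- Edges form a set, so they count vertices only if distinct vertices have distinct neighbourhoods,
which is what `hG` provides. -/
theorem codegree_neighborhoodHypergraph (hG : ∀ u v, u = v ∨ ∃ w, G.Adj u w ∧ ¬ G.Adj v w)
    (v w : V) : G.neighborhoodHypergraph.codegree v w =
      (Finset.univ.filter fun u => G.Adj v u ∧ G.Adj w u).card := by
  have hinj : Function.Injective fun v => G.neighborFinset v := by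
    intro u v h
    refine (hG u v).resolve_right ?_
    rintro ⟨w, hu, hv⟩
    rw [← G.mem_neighborFinset] at hu hv
    exact hv (Finset.ext_iff.1 h w |>.1 hu)
  rw [FiniteHypergraph.codegree, neighborhoodHypergraph, Finset.filter_image,
    Finset.card_image_of_injective _ hinj]
  congr 1
  ext u
  simp [G.adj_comm]

theorem neighborhoodHypergraph_isFull (h : ∀ v, ∃ w, G.Adj w v) :
    G.neighborhoodHypergraph.IsFull := by
  intro v
  obtain ⟨w, hw⟩ := h v
  exact ⟨_, (G.neighborEdge w).2, G.mem_neighborEdge.2 hw⟩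

variable {G} {W : Type*} [Fintype W] [DecidableEq W] [Nonempty W] {H : SimpleGraph W}
  [DecidableRel H.Adj]

theorem Iso.neighborhoodHypergraph_isIsomorphic (f : G ≃g H) :
    G.neighborhoodHypergraph.IsIsomorphic H.neighborhoodHypergraph := by
  have hmap : ∀ v, (H.neighborFinset (f v)).map f.toEquiv.symm.toEmbedding =
      G.neighborFinset v := by
    intro v
    ext w
    rw [Finset.mem_map_equiv, mem_neighborFinset, mem_neighborFinset, Equiv.symm_symm]
    exact f.map_adj_iff
  refine ⟨f.toEquiv, fun e => ?_⟩
  simp only [neighborhoodHypergraph, Finset.mem_image, Finset.mem_univ, true_and]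
  constructor
  · rintro ⟨v, hv⟩
    exact ⟨f v, Finset.map_injective _ ((hmap v).trans hv)⟩
  · rintro ⟨w, rfl⟩
    obtain ⟨v, rfl⟩ := f.surjective w
    exact ⟨v, (hmap v).symm⟩

end SimpleGraph

/-! ### Classical non-isomorphism for the magic square -/

namespace BCS

/-- A consistent choice of satisfying assignments would solve the magic square. -/
theorem magicSquare_not_consistent (w : ∀ k, magicSquare.Sat k) :
    ∃ k l, magicSquare.graph.Adj ⟨k, w k⟩ ⟨l, w l⟩ := by
  by_contra! hw
  have hcons : ∀ k l i (hk : i ∈ magicSquare.support k) (hl : i ∈ magicSquare.support l),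
      (w k).1 ⟨i, hk⟩ = (w l).1 ⟨i, hl⟩ :=
    fun k l i hk hl => not_not.1 fun h => hw k l ⟨i, hk, hl, h⟩
  let x : Fin 3 × Fin 3 → ZMod 2 := fun i => (w (.inl i.1)).1 ⟨i, by simp [magicSquare]⟩
  have hx : ∀ k, ∑ i ∈ magicSquare.support k, x i = magicSquare.parity k := by
    intro k
    rw [← (w k).2, ← Finset.sum_coe_sort]
    exact Finset.sum_congr rfl fun i _ => hcons _ _ _ _ _
  -- The parity contradiction: the total of the nine variables is `0` by rows and `0 + 0 + 1` by
  -- columns.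
  have hrows : ∑ i, x i = 0 := by
    rw [← Finset.sum_fiberwise _ (fun i : Fin 3 × Fin 3 => i.1)]
    exact Finset.sum_eq_zero fun r _ => hx (.inl r)
  have hcols : ∑ i, x i = 1 := by
    rw [← Finset.sum_fiberwise _ (fun i : Fin 3 × Fin 3 => i.2)]
    refine (Finset.sum_congr rfl fun c _ => hx (.inr c)).trans ?_
    simp [magicSquare]
  exact zero_ne_one (hrows.symm.trans hcols)

/-- The number of common neighbours in the graph of the magic square. -/
theorem card_common_neighbors_magicSquare : ∀ u v : magicSquare.Vertex,
    (Finset.univ.filter fun w => magicSquare.graph.Adj u w ∧ magicSquare.graph.Adj v w).card =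
      if u = v then 9 else if u.1 = v.1 then 4 else if u.1.isLeft = v.1.isLeft then 3 else
        if magicSquare.graph.Adj u v then 2 else 4 := by
  -- The degree is `9 = 3 + 3 · 2`: the other assignments of the same constraint, and half of the
  -- four assignments of each crossing constraint.
  decide +kernel

set_option synthInstance.maxSize 1000 in
theorem magicSquare_exists_neighbor : ∀ u v : magicSquare.Vertex,
    u = v ∨ ∃ w, magicSquare.graph.Adj u w ∧ ¬ magicSquare.graph.Adj v w := by
  decide +kernel

set_option synthInstance.maxSize 1000 in
theorem homogenization_magicSquare_exists_neighbor :
    ∀ u v : magicSquare.homogenization.Vertex,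
    u = v ∨ ∃ w, magicSquare.homogenization.graph.Adj u w ∧
      ¬ magicSquare.homogenization.graph.Adj v w := by
  decide +kernel

/-- The zero assignment of a homogeneous constraint. -/
def zeroVertex (l : Fin 3 ⊕ Fin 3) : magicSquare.homogenization.Vertex :=
  ⟨l, fun _ => 0, Finset.sum_const_zero⟩

/-- These are the values that `card_common_neighbors_magicSquare` gives for equal vertices, for
parallel constraints and for crossing non-adjacent vertices. Locally the two graphs look alike; the
obstruction is the consistency of all six vertices. -/
theorem card_common_neighbors_zeroVertex : ∀ k l,
    (Finset.univ.filter fun w => magicSquare.homogenization.graph.Adj (zeroVertex k) w ∧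
      magicSquare.homogenization.graph.Adj (zeroVertex l) w).card =
      if k = l then 9 else if k.isLeft = l.isLeft then 3 else 4 := by
  decide +kernel

/-- The codegree `3` only occurs for parallel constraints. The codegree `4` is ambiguous between one
constraint with two assignments and crossing non-adjacent vertices; using a second row excludes the
former. -/
theorem magicSquare_not_isIsomorphic : ¬ magicSquare.graph.neighborhoodHypergraph.IsIsomorphic
    magicSquare.homogenization.graph.neighborhoodHypergraph := by
  intro h
  obtain ⟨f, hf⟩ := h.exists_equiv_codegree_eq
  let u : Fin 3 ⊕ Fin 3 → magicSquare.Vertex := fun l => f.symm (zeroVertex l)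
  have hu : ∀ k l, (if u k = u l then 9 else if (u k).1 = (u l).1 then 4 else
      if (u k).1.isLeft = (u l).1.isLeft then 3 else
        if magicSquare.graph.Adj (u k) (u l) then 2 else 4) =
      if k = l then 9 else if k.isLeft = l.isLeft then 3 else 4 := by
    intro k l
    have h := hf (u k) (u l)
    rwa [SimpleGraph.codegree_neighborhoodHypergraph _ magicSquare_exists_neighbor,
      SimpleGraph.codegree_neighborhoodHypergraph _ homogenization_magicSquare_exists_neighbor,
      card_common_neighbors_magicSquare, f.apply_symm_apply, f.apply_symm_apply,
      card_common_neighbors_zeroVertex] at h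
  have hsame : ∀ k l, k ≠ l → k.isLeft = l.isLeft →
      (u k).1 ≠ (u l).1 ∧ (u k).1.isLeft = (u l).1.isLeft := by
    intro k l hkl hs
    have := hu k l
    rw [if_neg hkl, if_pos hs] at this
    split_ifs at this with h₁ h₂ h₃ <;> first | omega | exact ⟨h₂, h₃⟩
  have hcross : ∀ k l, k.isLeft ≠ l.isLeft →
      ((u k).1.isLeft = (u l).1.isLeft → (u k).1 = (u l).1) ∧
      ((u k).1 ≠ (u l).1 → ¬ magicSquare.graph.Adj (u k) (u l)) := by
    intro k l hs
    have := hu k l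
    rw [if_neg (fun h => hs (congrArg _ h)), if_neg hs] at this
    split_ifs at this with h₁ h₂ h₃ h₄ <;> try omega
    · exact ⟨fun _ => h₂, fun h => absurd h₂ h⟩
    · exact ⟨fun h => absurd h h₃, fun _ => h₄⟩
  -- If a row and a column landed on the same side, they would share a constraint. Any other row `s`
  -- would then share it too, contradicting `hsame` for `r` and `s`.
  have hside : ∀ r c : Fin 3, (u (.inl r)).1.isLeft ≠ (u (.inr c)).1.isLeft := by
    intro r c h
    obtain ⟨s, hs⟩ := exists_ne r
    have h₁ := hsame (.inl r) (.inl s) (by simpa using hs.symm) rfl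
    have h₂ := (hcross (.inl r) (.inr c) (by simp)).1 h
    have h₃ := (hcross (.inl s) (.inr c) (by simp)).1 (h₁.2.symm.trans h)
    exact h₁.1 (h₂.trans h₃.symm)
  have hne : ∀ k l, k.isLeft ≠ l.isLeft → (u k).1.isLeft ≠ (u l).1.isLeft := by
    rintro (r | c) (s | d) h
    exacts [absurd rfl h, hside r d, (hside s c).symm, absurd rfl h]
  have hinj : Function.Injective fun l => (u l).1 := by
    intro k l h
    by_contra hkl
    by_cases hs : k.isLeft = l.isLeft
    · exact (hsame k l hkl hs).1 h
    · exact hne k l hs (congrArg _ h)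
  have hnadj : ∀ k l, ¬ magicSquare.graph.Adj (u k) (u l) := by
    intro k l
    by_cases hkl : k = l
    · exact hkl ▸ magicSquare.graph.loopless.irrefl _
    by_cases hs : k.isLeft = l.isLeft
    -- Distinct parallel lines have no variable in common, so there is nothing to conflict on.
    · rintro ⟨i, hk, hl, -⟩
      obtain ⟨h₁, h₂⟩ := hsame k l hkl hs
      rcases hk' : (u k).1 with r | r <;> rcases hl' : (u l).1 with s | s <;>
        simp [hk', hl', magicSquare] at h₁ h₂ hk hl <;> exact h₁ (hk.symm.trans hl)
    · exact (hcross k l hs).2 fun h => hne k l hs (congrArg _ h)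
  -- An injection of the six constraints into themselves is onto, so every constraint carries one of
  -- the pairwise non-adjacent vertices.
  choose g hg using (Finite.injective_iff_surjective.1 hinj)
  obtain ⟨k, l, hkl⟩ := magicSquare_not_consistent fun k => hg k ▸ (u (g k)).2
  have hv : ∀ k, (⟨k, hg k ▸ (u (g k)).2⟩ : magicSquare.Vertex) = u (g k) := by
    intro k
    have : ∀ (v : magicSquare.Vertex) (h : v.1 = k),
        (⟨k, h ▸ v.2⟩ : magicSquare.Vertex) = v := by
      rintro v rfl
      rfl
    exact this _ _
  rw [hv, hv] at hkl
  exact hnadj _ _ hkl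

end BCS

theorem mainTheorem7 :
    (∃ (Λ₁ : FiniteHypergraph BCS.magicSquare.Vertex)
        (Λ₂ : FiniteHypergraph BCS.magicSquare.homogenization.Vertex),
      Λ₁ = BCS.magicSquare.graph.neighborhoodHypergraph ∧
      Λ₂ = BCS.magicSquare.homogenization.graph.neighborhoodHypergraph ∧
      Λ₁.IsFull ∧ Λ₂.IsFull ∧
      (isoGame BCS.magicSquare.graph
        BCS.magicSquare.homogenization.graph).HasPerfectQuantumStrategy ∧
      ¬ Nonempty (BCS.magicSquare.graph ≃g BCS.magicSquare.homogenization.graph) ∧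
      Λ₁.QuantumIsomorphic Λ₂ ∧
      ¬ Λ₁.LocIsomorphic Λ₂ ∧
      ¬ Λ₁.IsIsomorphic Λ₂) ∧
    (∀ (V₁ V₂ : Type*) [Fintype V₁] [DecidableEq V₁] [Nonempty V₁]
        [Fintype V₂] [DecidableEq V₂] [Nonempty V₂]
        (G₁ : SimpleGraph V₁) [DecidableRel G₁.Adj] (G₂ : SimpleGraph V₂) [DecidableRel G₂.Adj],
      (∃ φ : GameAlgebra
            (G₁.neighborhoodHypergraph.hypIsoGame G₂.neighborhoodHypergraph) →⋆ₐ[ℂ]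
          GameAlgebra (isoGame G₁ G₂),
        Function.Surjective φ ∧
        ∀ v₁ v₂, φ (GameAlgebra.gen _ (.inl (.inl v₁)) (.inl (.inr v₂))) =
          GameAlgebra.gen _ (.inl v₁) (.inr v₂)) ∧
      ((isoGame G₁ G₂).HasPerfectQuantumStrategy →
        G₁.neighborhoodHypergraph.QuantumIsomorphic G₂.neighborhoodHypergraph)) := by
  refine ⟨⟨_, _, rfl, rfl, ?_, ?_, BCS.magicSquare_hasPerfectQuantumStrategy, ?_,
    quantumIsomorphic_neighborhoodHypergraph _ _ BCS.magicSquare_hasPerfectQuantumStrategy,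
    fun h => BCS.magicSquare_not_isIsomorphic h.isIsomorphic, BCS.magicSquare_not_isIsomorphic⟩,
    fun V₁ V₂ _ _ _ _ _ _ G₁ _ G₂ _ =>
      ⟨exists_surjective_starAlgHom_neighborhoodHypergraph G₁ G₂,
        quantumIsomorphic_neighborhoodHypergraph G₁ G₂⟩⟩
  · exact SimpleGraph.neighborhoodHypergraph_isFull _ (by decide +kernel)
  · exact SimpleGraph.neighborhoodHypergraph_isFull _ (by decide +kernel)
  · rintro ⟨f⟩
    exact BCS.magicSquare_not_isIsomorphic f.neighborhoodHypergraph_isIsomorphic
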